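/- **Setting.** Time is slotted. A primary user $p$ (PU) receives packets according to a Bernoulli process of rate $\lambda_p\in(0,1)$ and stores them in a first-come-first-served queue $Q_p$; $N\ge 2$ backlogged secondary users (SUs) share a first-come-first-served relay queue $Q_r$. In each slot: if $Q_p$ is non-empty, the PU transmits its head-of-line packet with power $P_0$; the packet leaves the system if the primary destination decodes it, moves to $Q_r$ if the destination does not decode it but at least one SU does, and otherwise stays in $Q_p$. If $Q_p$ is empty and $Q_r$ is not, a power allocation and node selection policy picks, from the current gains of the links from the SUs to the primary and secondary destinations, an SU $r^*$ that relays the head of $Q_r$ and an SU $s^*$ that transmits a packet of its own, with powers in $[0,P_{\max}]$; the transmission of $s^*$ is interference at the primary destination, and the relayed packet leaves the system if it is decoded and otherwise stays in $Q_r$. An arrival in a slot joins $Q_p$ at the end of that slot. A transmission is decoded iff $\log_2(1+\mathrm{SINR})\ge R_0$, with noise variance $N_0$. Channels are Rayleigh block fading: the squared gains are exponentially distributed (mean $\sigma_p^2$ for the link from the PU to the primary destination, mean $1$ for all other links), and gains and arrivals are independent of each other and across slots. The policy is arbitrary (measurable); in particular it may combine equal or adaptive power allocation with best-secondary-link or best-primary-link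 node selection. Let $f_p$, $f_{ps}$, $f_{r^*}$ be the probabilities that, in one slot, respectively, the primary destination decodes the PU, at least one SU decodes the PU, and the primary destination decodes the relay $r^*$ when $r^*$ and $s^*$ transmit as prescribed by the policy. Put $\mu_p=f_p+(1-f_p)f_{ps}$. **Theorem.** Suppose that the system is stable: $\lambda_p<\dfrac{f_{r^*}[f_p+(1-f_p)f_{ps}]}{f_{r^*}+(1-f_p)f_{ps}}$. Then, for any initial numbers of packets, the joint law of the lengths of $Q_p$ and $Q_r$ at the beginning of slot $n$ converges, as $n\to\infty$, to a probability law on $\mathbb{N}^2$ whose means $N_p$ (for $Q_p$) and $N_r$ (for $Q_r$) are $$N_p=\frac{-\lambda_p^2+\lambda_p}{\mu_p-\lambda_p},\qquad N_r=\frac{r\lambda_p^2+s\lambda_p}{\delta\lambda_p^2+\zeta\lambda_p+\eta},$$ where $$r=f_{ps}(1-f_p)\Big[\frac{f_{r^*}-f_p}{\mu_p}-f_{r^*}-f_{ps}(1-f_p)\Big],\quad s=f_{ps}(1-f_p)\mu_p,\quad \delta=f_{r^*}+f_{ps}(1-f_p),$$ $$\zeta=\mu_p\big[-2f_{r^*}-f_{ps}(1-f_p)\big],\quad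 \eta=\mu_p^2f_{r^*}.$$ Moreover, almost surely, every arriving packet has a finite queuing delay (the number of slots at whose beginning it is in $Q_p$ or $Q_r$), and the average of the delays of the packets that arrive in the first $n$ slots converges, as $n\to\infty$, to $$\tau=\frac{N_p+N_r}{\lambda_p}.$$ -/

import Mathlib

open MeasureTheory ProbabilityTheory Filter Topology

noncomputable section

namespace CognitiveRelay

/-- Parameters of the network. The secondary links all have mean squared gain `1`. -/
structure Network where
  /-- number of secondary users (SUs) -/
  N : ℕ
  two_le_N : 2 ≤ N
  /-- target transmission rate -/
  R₀ : ℝ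
  R₀_pos : 0 < R₀
  /-- transmit power of the primary user (PU) -/
  P₀ : ℝ
  P₀_pos : 0 < P₀
  /-- noise variance -/
  N₀ : ℝ
  N₀_pos : 0 < N₀
  /-- maximal transmit power of an SU -/
  Pmax : ℝ
  Pmax_pos : 0 < Pmax
  /-- mean squared gain of the link from the PU to its destination -/
  varP : ℝ
  varP_pos : 0 < varP
  /-- arrival rate at the PU -/
  lam : ℝ
  lam_pos : 0 < lam
  lam_lt_one : lam < 1

/-- Squared gains of the links from the SUs to the secondary destination (first component) and
to the primary destination (second component) in one slot. -/
abbrev CSI (N : ℕ) : Type := (Fin N → ℝ) × (Fin N → ℝ)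

/-- What the cluster supervision block prescribes for an idle slot of the PU in which the relay
queue is non-empty. A silent node is one whose power is `0`. -/
structure Transmission (N : ℕ) where
  /-- the SU transmitting a packet of its own -/
  secondary : Fin N
  /-- the SU relaying a primary packet -/
  relay : Fin N
  secondaryPower : ℝ
  relayPower : ℝ

/-- A joint power allocation and node selection policy: any measurable rule that prescribes, from
the current gains of the links from the SUs to both destinations, the two nodes and their powers,
within the power constraint, such that two simultaneously active nodes are distinct. -/
structure Policy (S : Network) where
  choose : CSI S.N → Transmission S.N
  measurable_secondary : Measurable fun h => (choose h).secondary
  measurable_relay : Measurable fun h => (choose h).relay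
  measurable_secondaryPower : Measurable fun h => (choose h).secondaryPower
  measurable_relayPower : Measurable fun h => (choose h).relayPower
  secondaryPower_mem : ∀ h, 0 ≤ h → (choose h).secondaryPower ∈ Set.Icc 0 S.Pmax
  relayPower_mem : ∀ h, 0 ≤ h → (choose h).relayPower ∈ Set.Icc 0 S.Pmax
  ne : ∀ h, 0 ≤ h → (choose h).secondaryPower ≠ 0 → (choose h).relayPower ≠ 0 →
    (choose h).secondary ≠ (choose h).relay

namespace Network

variable (S : Network)

/-! ### The four policies: equal or adaptive power, best secondary or best primary link -/

/-- The first index in `T` at which `h` is maximal over `T`. -/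
def best (T : Finset (Fin S.N)) (h : Fin S.N → ℝ) : Fin S.N :=
  if hT : (T.filter fun i => ∀ j ∈ T, h j ≤ h i).Nonempty then Finset.min' _ hT
  else ⟨0, by have := S.two_le_N; omega⟩

/-- The least power that gives rate `R₀` on a link with squared gain `h` and the given noise plus
interference power, and `0` (silence) if this exceeds `Pmax`. -/
def adaptivePower (noise h : ℝ) : ℝ :=
  if 0 < h ∧ (2 ^ S.R₀ - 1) * noise / h ≤ S.Pmax then (2 ^ S.R₀ - 1) * noise / h else 0

/-- Equal power, best secondary link. -/
def chooseEPBSL (h : CSI S.N) : Transmission S.N where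
  secondary := S.best Finset.univ h.1
  relay := S.best (Finset.univ.erase (S.best Finset.univ h.1)) h.2
  secondaryPower := S.Pmax
  relayPower := S.Pmax

/-- Equal power, best primary link. -/
def chooseEPBPL (h : CSI S.N) : Transmission S.N where
  secondary := S.best (Finset.univ.erase (S.best Finset.univ h.2)) h.1
  relay := S.best Finset.univ h.2
  secondaryPower := S.Pmax
  relayPower := S.Pmax

/-- Adaptive power, best secondary link. If the secondary node is silent, then the relay is the SU
with the best link to the primary destination among all SUs. -/
def chooseAPBSL (h : CSI S.N) : Transmission S.N :=
  let s := S.best Finset.univ h.1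
  let Ps := S.adaptivePower S.N₀ (h.1 s)
  let r := if Ps = 0 then S.best Finset.univ h.2 else S.best (Finset.univ.erase s) h.2
  ⟨s, r, Ps, S.adaptivePower (S.N₀ + Ps * h.2 s) (h.2 r)⟩

/-- Adaptive power, best primary link. If the relay is silent, then the secondary node is the SU
with the best link to the secondary destination among all SUs. -/
def chooseAPBPL (h : CSI S.N) : Transmission S.N :=
  let r := S.best Finset.univ h.2
  let s := S.best (Finset.univ.erase r) h.1
  let Ps := S.adaptivePower S.N₀ (h.1 s)
  let Pr := S.adaptivePower (S.N₀ + Ps * h.2 s) (h.2 r)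
  let s' := if Pr = 0 then S.best Finset.univ h.1 else s
  ⟨s', r, S.adaptivePower S.N₀ (h.1 s'), Pr⟩

lemma best_mem {T : Finset (Fin S.N)} (hT : T.Nonempty) (h : Fin S.N → ℝ) : S.best T h ∈ T := by
  obtain ⟨i, hi, hmax⟩ := T.exists_max_image h hT
  have hne : (T.filter fun i => ∀ j ∈ T, h j ≤ h i).Nonempty :=
    ⟨i, Finset.mem_filter.2 ⟨hi, hmax⟩⟩
  have := Finset.min'_mem _ hne
  rw [best, dif_pos hne]
  exact (Finset.mem_filter.1 this).1

lemma erase_nonempty (i : Fin S.N) : ((Finset.univ : Finset (Fin S.N)).erase i).Nonempty := by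
  rw [← Finset.card_pos, Finset.card_erase_of_mem (Finset.mem_univ _), Finset.card_univ,
    Fintype.card_fin]
  have := S.two_le_N
  omega

lemma best_erase_ne (i : Fin S.N) (h : Fin S.N → ℝ) : S.best (Finset.univ.erase i) h ≠ i :=
  Finset.ne_of_mem_erase (S.best_mem (S.erase_nonempty i) h)

lemma measurable_best (T : Finset (Fin S.N)) : Measurable (S.best T) := by
  have hF : Measurable fun (h : Fin S.N → ℝ) (i : Fin S.N) =>
      (i ∈ T ∧ ∀ j ∈ T, h j ≤ h i : Prop) := by
    refine measurable_pi_iff.2 fun i => ?_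
    refine measurable_to_prop ?_
    have : (fun h : Fin S.N → ℝ => (i ∈ T ∧ ∀ j ∈ T, h j ≤ h i : Prop)) ⁻¹' {True}
        = {h | i ∈ T} ∩ ⋂ j ∈ T, {h | h j ≤ h i} := by
      ext h; simp
    rw [this]
    exact (MeasurableSet.const _).inter (Finset.measurableSet_biInter _ fun j _ =>
      measurableSet_le (measurable_pi_apply j) (measurable_pi_apply i))
  classical
  let G : (Fin S.N → Prop) → Fin S.N := fun p =>
    if hT : (Finset.univ.filter p).Nonempty then Finset.min' _ hT
    else ⟨0, by have := S.two_le_N; omega⟩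
  have hG : Measurable G := measurable_of_finite G
  have : S.best T = G ∘ fun h i => (i ∈ T ∧ ∀ j ∈ T, h j ≤ h i : Prop) := by
    funext h
    have : (T.filter fun i => ∀ j ∈ T, h j ≤ h i)
        = Finset.univ.filter fun i => (i ∈ T ∧ ∀ j ∈ T, h j ≤ h i) := by
      ext i; simp
    simp only [best, G, Function.comp, this]
    congr!
  rw [this]
  exact hG.comp hF

lemma measurable_eval_index {α : Type*} [MeasurableSpace α] {f : α → Fin S.N → ℝ}
    {i : α → Fin S.N} (hf : Measurable f) (hi : Measurable i) : Measurable fun a => f a (i a) :=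
  (measurable_from_prod_countable_left (f := fun p : (Fin S.N → ℝ) × Fin S.N => p.1 p.2)
    fun i => measurable_pi_apply i).comp (hf.prodMk hi)

lemma measurable_best_erase {α : Type*} [MeasurableSpace α] {f : α → Fin S.N → ℝ}
    {i : α → Fin S.N} (hf : Measurable f) (hi : Measurable i) :
    Measurable fun a => S.best (Finset.univ.erase (i a)) (f a) := by
  have hB := S.measurable_best
  generalize S.best = B at hB ⊢
  refine measurable_to_countable' fun j => ?_
  have : (fun a => B (Finset.univ.erase (i a)) (f a)) ⁻¹' {j}
      = ⋃ l, i ⁻¹' {l} ∩ (fun a => B (Finset.univ.erase l) (f a)) ⁻¹' {j} := by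
    ext a; simp
  rw [this]
  exact MeasurableSet.iUnion fun l => (hi (measurableSet_singleton l)).inter
    (((hB _).comp hf) (measurableSet_singleton j))

lemma measurable_adaptivePower {α : Type*} [MeasurableSpace α] {f g : α → ℝ}
    (hf : Measurable f) (hg : Measurable g) :
    Measurable fun a => S.adaptivePower (f a) (g a) := by
  have hq : Measurable fun a => (2 ^ S.R₀ - 1) * f a / g a := (hf.const_mul _).div hg
  exact Measurable.ite ((measurableSet_lt measurable_const hg).inter
    (measurableSet_le hq measurable_const)) hq measurable_const

lemma adaptivePower_mem {noise : ℝ} (hn : 0 ≤ noise) (h : ℝ) :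
    S.adaptivePower noise h ∈ Set.Icc 0 S.Pmax := by
  unfold adaptivePower
  split_ifs with hc
  · refine ⟨div_nonneg (mul_nonneg ?_ hn) hc.1.le, hc.2⟩
    have := Real.one_le_rpow (x := 2) (by norm_num) S.R₀_pos.le
    linarith
  · exact ⟨le_rfl, S.Pmax_pos.le⟩

/-- The policy EP-BSL. -/
def policyEPBSL : Policy S where
  choose := S.chooseEPBSL
  measurable_secondary := (S.measurable_best _).comp measurable_fst
  measurable_relay :=
    S.measurable_best_erase measurable_snd ((S.measurable_best _).comp measurable_fst)
  measurable_secondaryPower := measurable_const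
  measurable_relayPower := measurable_const
  secondaryPower_mem _ _ := ⟨S.Pmax_pos.le, le_rfl⟩
  relayPower_mem _ _ := ⟨S.Pmax_pos.le, le_rfl⟩
  ne _ _ _ _ := (S.best_erase_ne _ _).symm

/-- The policy EP-BPL. -/
def policyEPBPL : Policy S where
  choose := S.chooseEPBPL
  measurable_secondary :=
    S.measurable_best_erase measurable_fst ((S.measurable_best _).comp measurable_snd)
  measurable_relay := (S.measurable_best _).comp measurable_snd
  measurable_secondaryPower := measurable_const
  measurable_relayPower := measurable_const
  secondaryPower_mem _ _ := ⟨S.Pmax_pos.le, le_rfl⟩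
  relayPower_mem _ _ := ⟨S.Pmax_pos.le, le_rfl⟩
  ne _ _ _ _ := S.best_erase_ne _ _

lemma noise_nonneg {Ps h : ℝ} (hP : 0 ≤ Ps) (hh : 0 ≤ h) : 0 ≤ S.N₀ + Ps * h :=
  add_nonneg S.N₀_pos.le (mul_nonneg hP hh)

lemma measurable_APBSL_s : Measurable fun h : CSI S.N => (S.chooseAPBSL h).secondary :=
  (S.measurable_best _).comp measurable_fst

lemma measurable_APBSL_Ps : Measurable fun h : CSI S.N => (S.chooseAPBSL h).secondaryPower :=
  S.measurable_adaptivePower measurable_const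
    (S.measurable_eval_index measurable_fst S.measurable_APBSL_s)

lemma measurable_APBSL_r : Measurable fun h : CSI S.N => (S.chooseAPBSL h).relay :=
  Measurable.ite (S.measurable_APBSL_Ps (measurableSet_singleton 0))
    ((S.measurable_best _).comp measurable_snd)
    (S.measurable_best_erase measurable_snd S.measurable_APBSL_s)

/-- The policy AP-BSL. -/
def policyAPBSL : Policy S where
  choose := S.chooseAPBSL
  measurable_secondary := S.measurable_APBSL_s
  measurable_relay := S.measurable_APBSL_r
  measurable_secondaryPower := S.measurable_APBSL_Ps
  measurable_relayPower := S.measurable_adaptivePower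
    (measurable_const.add (S.measurable_APBSL_Ps.mul
      (S.measurable_eval_index measurable_snd S.measurable_APBSL_s)))
    (S.measurable_eval_index measurable_snd S.measurable_APBSL_r)
  secondaryPower_mem _ _ := S.adaptivePower_mem S.N₀_pos.le _
  relayPower_mem _ hh := S.adaptivePower_mem
    (S.noise_nonneg (S.adaptivePower_mem S.N₀_pos.le _).1 (hh.2 _)) _
  ne h _ hs _ := by
    have : (S.chooseAPBSL h).relay
        = S.best (Finset.univ.erase (S.chooseAPBSL h).secondary) h.2 := if_neg hs
    rw [this]
    exact (S.best_erase_ne _ _).symm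

lemma measurable_APBPL_r : Measurable fun h : CSI S.N => (S.chooseAPBPL h).relay :=
  (S.measurable_best _).comp measurable_snd

lemma measurable_APBPL_s₀ : Measurable fun h : CSI S.N =>
    S.best (Finset.univ.erase (S.best Finset.univ h.2)) h.1 :=
  S.measurable_best_erase measurable_fst S.measurable_APBPL_r

lemma measurable_APBPL_Pr : Measurable fun h : CSI S.N => (S.chooseAPBPL h).relayPower :=
  S.measurable_adaptivePower
    (measurable_const.add ((S.measurable_adaptivePower measurable_const
      (S.measurable_eval_index measurable_fst S.measurable_APBPL_s₀)).mul
      (S.measurable_eval_index measurable_snd S.measurable_APBPL_s₀)))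
    (S.measurable_eval_index measurable_snd S.measurable_APBPL_r)

lemma measurable_APBPL_s : Measurable fun h : CSI S.N => (S.chooseAPBPL h).secondary :=
  Measurable.ite (S.measurable_APBPL_Pr (measurableSet_singleton 0))
    ((S.measurable_best _).comp measurable_fst) S.measurable_APBPL_s₀

/-- The policy AP-BPL. -/
def policyAPBPL : Policy S where
  choose := S.chooseAPBPL
  measurable_secondary := S.measurable_APBPL_s
  measurable_relay := S.measurable_APBPL_r
  measurable_secondaryPower := S.measurable_adaptivePower measurable_const
    (S.measurable_eval_index measurable_fst S.measurable_APBPL_s)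
  measurable_relayPower := S.measurable_APBPL_Pr
  secondaryPower_mem _ _ := S.adaptivePower_mem S.N₀_pos.le _
  relayPower_mem _ hh := S.adaptivePower_mem
    (S.noise_nonneg (S.adaptivePower_mem S.N₀_pos.le _).1 (hh.2 _)) _
  ne h _ _ hr := by
    have : (S.chooseAPBPL h).secondary
        = S.best (Finset.univ.erase (S.chooseAPBPL h).relay) h.1 := if_neg hr
    rw [this]
    exact S.best_erase_ne _ _

/-! ### One time slot -/

/-- All the randomness of one slot. -/
abbrev Slot : Type := Bool × ℝ × (Fin S.N → ℝ) × (Fin S.N → ℝ) × (Fin S.N → ℝ)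

namespace Slot

variable {S}

/-- A packet arrives at the PU. -/
def arrival (x : S.Slot) : Prop := x.1 = true

/-- Squared gain of the link from the PU to the primary destination. -/
def hp (x : S.Slot) : ℝ := x.2.1

/-- Squared gains of the links from the PU to the SUs. -/
def hps (x : S.Slot) : Fin S.N → ℝ := x.2.2.1

/-- Squared gains of the links from the SUs to the secondary destination. -/
def hs (x : S.Slot) : Fin S.N → ℝ := x.2.2.2.1

/-- Squared gains of the links from the SUs to the primary destination. -/
def hr (x : S.Slot) : Fin S.N → ℝ := x.2.2.2.2

end Slot

/-- Law of one slot: Bernoulli arrival and Rayleigh fading, all independent. -/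
def slotLaw : Measure S.Slot :=
  (bernoulliMeasure true false ⟨S.lam, S.lam_pos.le, S.lam_lt_one.le⟩).prod
    ((expMeasure (1 / S.varP)).prod
      ((Measure.pi fun _ => expMeasure 1).prod
        ((Measure.pi fun _ => expMeasure 1).prod (Measure.pi fun _ => expMeasure 1))))

/-- No outage: the achievable rate at this signal-to-interference-plus-noise ratio supports the
target rate. -/
def NoOutage (sinr : ℝ) : Prop := S.R₀ ≤ Real.logb 2 (1 + sinr)

/-- The primary destination decodes the PU if the PU transmits. -/
def directSuccess (x : S.Slot) : Prop := S.NoOutage (S.P₀ * x.hp / S.N₀)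

/-- At least one SU decodes the PU if the PU transmits. -/
def clusterSuccess (x : S.Slot) : Prop := ∃ i, S.NoOutage (S.P₀ * x.hps i / S.N₀)

/-- The primary destination decodes the relay if the PU is idle and the relay queue is
non-empty; the transmission of the secondary node is interference for the relay link. -/
def relaySuccess (π : Policy S) (x : S.Slot) : Prop :=
  let c := π.choose (x.hs, x.hr)
  S.NoOutage (c.relayPower * x.hr c.relay / (S.N₀ + c.secondaryPower * x.hr c.secondary))

/-- Success probability of the direct link. -/
def fp : ℝ := S.slotLaw.real {x | S.directSuccess x}

/-- Probability that at least one SU decodes a transmitted primary packet. -/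
def fps : ℝ := S.slotLaw.real {x | S.clusterSuccess x}

/-- Success probability of the relay link. -/
def fr (π : Policy S) : ℝ := S.slotLaw.real {x | S.relaySuccess π x}

/-! ### Queues and delay -/

/-- Contents of the PU's queue and of the common relay queue, first come first served, head
first. A packet `some n` arrived during slot `n`; the packets `none` are those present at the
beginning. -/
abbrev Queues : Type := List (Option ℕ) × List (Option ℕ)

open Classical in
/-- Departures and relaying during a slot. A non-empty primary queue transmits its head, which
leaves to the destination, or else to the relay queue, or else stays. When the primary queue is
empty, the head of the relay queue, if any, is transmitted by the relay. -/
def serve (π : Policy S) (x : S.Slot) : Queues → Queues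
  | (k :: Qp, Qr) =>
    if S.directSuccess x then (Qp, Qr)
    else if S.clusterSuccess x then (Qp, Qr ++ [k])
    else (k :: Qp, Qr)
  | ([], k :: Qr) => if S.relaySuccess π x then ([], Qr) else ([], k :: Qr)
  | ([], []) => ([], [])

open Classical in
/-- The queues at the beginning of slot `n`, for a given realization `x` of all slots and initially
`a` packets in the PU's queue and `b` in the relay queue. -/
def queues (π : Policy S) (a b : ℕ) (x : ℕ → S.Slot) : ℕ → Queues
  | 0 => (List.replicate a none, List.replicate b none)
  | n + 1 =>
    let q := S.serve π (x n) (queues π a b x n)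
    (if (x n).arrival then q.1 ++ [some n] else q.1, q.2)

/-- The two queue lengths at the beginning of slot `n`. -/
def lengths (π : Policy S) (a b : ℕ) (x : ℕ → S.Slot) (n : ℕ) : ℕ × ℕ :=
  ((S.queues π a b x n).1.length, (S.queues π a b x n).2.length)

/-- The slots at whose beginning the packet that arrived in slot `k` is in one of the queues. -/
def slotsInSystem (π : Policy S) (a b : ℕ) (x : ℕ → S.Slot) (k : ℕ) : Set ℕ :=
  {n | some k ∈ (S.queues π a b x n).1 ∨ some k ∈ (S.queues π a b x n).2}

/-- Total queuing delay, in slots, of the packet that arrived in slot `k`. -/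
def delay (π : Policy S) (a b : ℕ) (x : ℕ → S.Slot) (k : ℕ) : ℕ :=
  (S.slotsInSystem π a b x k).ncard

open Classical in
/-- Average delay of the packets that arrived in slots `0, …, n - 1`. -/
def averageDelay (π : Policy S) (a b : ℕ) (x : ℕ → S.Slot) (n : ℕ) : ℝ :=
  (∑ k ∈ Finset.range n with (x k).arrival, (S.delay π a b x k : ℝ)) /
    ((Finset.range n).filter fun k => (x k).arrival).card

end Network

end CognitiveRelay

end

noncomputable section

namespace CognitiveRelay

/-! ### The chain of queue lengths -/

/-! A slot acts on the queue lengths only through four bits (arrival, direct link, cluster, relay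
link), so the lengths form a Markov chain on the quarter plane driven by i.i.d. outcomes. A slot
with non-empty primary queue ignores the relay bit and an idle slot ignores the direct and cluster
bits, so only the two corresponding marginals of the outcome law enter; `StableLaw` records them.

The stationary means come from Poisson equations `T h = h + m - g` rather than from generating
functions. The drift of a quadratic polynomial is affine on each of the three regions (primary busy,
relay only, empty), so for `g` a queue length the equation is a small linear system, solved in
`exists_isPoisson_fst` and `exists_isPoisson_snd`; a linear `h` does it for the indicator of the
empty state. Stability provides a linear function with negative drift (`exists_drift`), hence an
exponential Lyapunov function and fourth moments bounded in time (`exists_lyapunov`). These control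
the martingale attached to a Poisson solution, which gives the almost sure averages in
`IsDriving.ae_tendsto_average`.

For the limit law, the dynamics is monotone, so the chain started empty increases stochastically and
its law converges; the moment bounds prevent loss of mass, and a Cesàro argument identifies the
means (`exists_limit_law`). Any other start couples with the empty one as soon as the larger walk
empties, which happens almost surely because the empty state has positive frequency
(`IsDriving.tendsto_law`).

For the delay, summing presence indicators over packets or over slots gives Little's law pathwise
(`IsOccupancy.tendsto_sum_ncard`): total delay and accumulated length differ only by a contribution
of the initial packets and of the stretch up to the next empty time. Dividing by the arrival count,
governed by the strong law, gives the average delay. -/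

/-- What matters of a slot for the queue lengths: whether there is an arrival, and whether the
direct link, the links to the cluster, and the relay link succeed. -/
abbrev Outcome : Type := Bool × Bool × Bool × Bool

/-- Evolution of the two queue lengths in one slot. -/
def move : ℕ × ℕ → Outcome → ℕ × ℕ
  | (i + 1, j), e =>
    (bif e.2.1 || e.2.2.1 then i + e.1.toNat else i + 1 + e.1.toNat,
      bif !e.2.1 && e.2.2.1 then j + 1 else j)
  | (0, j + 1), e => (e.1.toNat, bif e.2.2.2 then j else j + 1)
  | (0, 0), e => (e.1.toNat, 0)

/-- The queue lengths at the beginning of slot `n`, started from `y`. -/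
def walk (y : ℕ × ℕ) (x : ℕ → Outcome) : ℕ → ℕ × ℕ
  | 0 => y
  | n + 1 => move (walk y x n) (x n)

/-- If both primary queues are busy, or both idle, the two states undergo the same event, up to
service of an empty relay queue. If only the larger one is busy, its relay queue cannot shrink and
its primary queue loses at most the extra packet. -/
lemma move_mono (e : Outcome) : Monotone fun y => move y e := by
  rintro ⟨i, j⟩ ⟨i', j'⟩ ⟨h1, h2⟩
  obtain ⟨a, d, c, r⟩ := e
  simp only at h1 h2
  rcases i with _ | i <;> rcases j with _ | j <;> rcases i' with _ | i' <;> rcases j' with _ | j' <;>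
    cases a <;> cases d <;> cases c <;> cases r <;>
    simp only [move, Prod.mk_le_mk, Bool.toNat, cond_true, cond_false, Bool.or_true, Bool.or_false, Bool.not_true,
      Bool.not_false, Bool.and_true, Bool.and_false] <;>
    omega

lemma walk_mono {y y' : ℕ × ℕ} (h : y ≤ y') (x : ℕ → Outcome) (n : ℕ) :
    walk y x n ≤ walk y' x n := by
  induction n with
  | zero => exact h
  | succ n ih => exact move_mono (x n) ih

lemma walk_congr (y : ℕ × ℕ) {x x' : ℕ → Outcome} {n : ℕ} (h : ∀ m < n, x m = x' m) :
    walk y x n = walk y x' n := by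
  induction n with
  | zero => rfl
  | succ n ih =>
    rw [walk, walk, ih fun m hm => h m (hm.trans n.lt_succ_self), h n n.lt_succ_self]

/-- Walks driven by the same outcomes have merged once the larger one has been empty. -/
lemma walk_eq_of_walk_eq_zero {y y' : ℕ × ℕ} (h : y ≤ y') {x : ℕ → Outcome} {m n : ℕ}
    (h0 : walk y' x m = 0) (hmn : m ≤ n) : walk y x n = walk y' x n := by
  induction n, hmn using Nat.le_induction with
  | base =>
    have h1 := walk_mono h x m
    rw [h0] at h1 ⊢
    exact le_antisymm h1 (zero_le)
  | succ n _ ih => rw [walk, walk, ih]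

/-- Expectation of a function of a Bernoulli variable of parameter `r`. -/
def bern (r : ℝ) (G : Bool → ℝ) : ℝ := r * G true + (1 - r) * G false

/-- A law of outcomes for which the arrivals and the three links are as independent as it matters,
and for which the queues are stable. -/
structure StableLaw where
  weight : Outcome → ℝ
  weight_nonneg : ∀ e, 0 ≤ weight e
  lam : ℝ
  p : ℝ
  q : ℝ
  f : ℝ
  lam_pos : 0 < lam
  f_pos : 0 < f
  transfer_nonneg : 0 ≤ (1 - p) * q
  sum_busy : ∀ G : Bool → Bool → Bool → ℝ, ∑ e, weight e * G e.1 e.2.1 e.2.2.1 =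
    bern lam fun a => bern p fun d => bern q fun c => G a d c
  sum_idle : ∀ G : Bool → Bool → ℝ, ∑ e, weight e * G e.1 e.2.2.2 =
    bern lam fun a => bern f fun r => G a r
  stable : lam * (f + (1 - p) * q) < f * (p + (1 - p) * q)

namespace StableLaw

variable (L : StableLaw)

/-- Probability that a packet moves from the primary queue to the relay queue. -/
def c : ℝ := (1 - L.p) * L.q

/-- Service rate of the primary queue. -/
def mu : ℝ := L.p + L.c

lemma c_nonneg : 0 ≤ L.c := L.transfer_nonneg

lemma stable' : 0 < L.f * L.mu - L.lam * (L.f + L.c) := sub_pos.2 L.stable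

/-- Stability rearranges to `f * (mu - lam) > lam * c`, whose right side is nonnegative. -/
lemma lam_lt_mu : L.lam < L.mu := by
  have h := L.stable'
  have h1 := mul_nonneg L.lam_pos.le L.c_nonneg
  have h2 := L.f_pos
  by_contra! h3
  nlinarith

lemma mu_pos : 0 < L.mu := L.lam_pos.trans L.lam_lt_mu

/-- The transition operator of the chain of queue lengths. -/
def T : Module.End ℝ (ℕ × ℕ → ℝ) :=
  ∑ e, L.weight e • LinearMap.funLeft ℝ ℝ fun y => move y e

lemma T_apply (g : ℕ × ℕ → ℝ) (y : ℕ × ℕ) : L.T g y = ∑ e, L.weight e * g (move y e) := by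
  simp [T, LinearMap.sum_apply, LinearMap.funLeft_apply]

lemma sum_weight : ∑ e, L.weight e = 1 := by
  have := L.sum_idle fun _ _ => 1
  simpa [bern] using this

lemma T_one : L.T 1 = 1 := by
  ext y
  simp [T_apply, sum_weight]

lemma T_mono {g g' : ℕ × ℕ → ℝ} (h : g ≤ g') : L.T g ≤ L.T g' := fun y => by
  rw [T_apply, T_apply]
  exact Finset.sum_le_sum fun e _ => mul_le_mul_of_nonneg_left (h _) (L.weight_nonneg e)

lemma T_pow_mono {g g' : ℕ × ℕ → ℝ} (h : g ≤ g') (n : ℕ) : (L.T ^ n) g ≤ (L.T ^ n) g' := by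
  induction n with
  | zero => simpa using h
  | succ n ih => simpa only [pow_succ', Module.End.mul_apply] using L.T_mono ih

lemma T_pow_one (n : ℕ) : (L.T ^ n) 1 = 1 := by
  induction n with
  | zero => rfl
  | succ n ih => rw [pow_succ', Module.End.mul_apply, ih, T_one]

lemma monotone_T_pow {g : ℕ × ℕ → ℝ} (h : Monotone g) (n : ℕ) : Monotone ((L.T ^ n) g) := by
  induction n with
  | zero => simpa using h
  | succ n ih =>
    rw [pow_succ', Module.End.mul_apply]
    intro y y' hy
    rw [T_apply, T_apply]
    exact Finset.sum_le_sum fun e _ =>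
      mul_le_mul_of_nonneg_left (ih (move_mono e hy)) (L.weight_nonneg e)

/-- Started from empty queues, the chain is stochastically increasing in time. -/
lemma monotone_T_pow_zero {g : ℕ × ℕ → ℝ} (h : Monotone g) :
    Monotone fun n => (L.T ^ n) g 0 := by
  refine monotone_nat_of_le_succ fun n => ?_
  -- Condition on the first step: from the empty state it leads to a state that is at least `0`,
  -- where the monotone function `T ^ n g` is no smaller.
  have h1 : (L.T ^ (n + 1)) g 0 = ∑ e, L.weight e * (L.T ^ n) g (move 0 e) := by
    rw [pow_succ', Module.End.mul_apply, T_apply]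
  have h2 : (L.T ^ n) g 0 = ∑ e, L.weight e * (L.T ^ n) g 0 := by
    rw [← Finset.sum_mul, sum_weight, one_mul]
  rw [h1, h2]
  exact Finset.sum_le_sum fun e _ =>
    mul_le_mul_of_nonneg_left (L.monotone_T_pow h n (zero_le)) (L.weight_nonneg e)

lemma T_busy (g : ℕ × ℕ → ℝ) (i j : ℕ) : L.T g (i + 1, j) =
    bern L.lam fun a => L.p * g (i + a.toNat, j) + L.c * g (i + a.toNat, j + 1)
      + (1 - L.mu) * g (i + 1 + a.toNat, j) := by
  have := L.sum_busy fun a d c => g (bif d || c then i + a.toNat else i + 1 + a.toNat,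
    bif !d && c then j + 1 else j)
  rw [T_apply]
  simp only [move]
  rw [this]
  simp only [bern, c, mu, Bool.or_true, Bool.or_false, Bool.not_true,
      Bool.not_false, Bool.and_true, Bool.and_false, cond_true, cond_false, Bool.toNat]
  ring

lemma T_relay (g : ℕ × ℕ → ℝ) (j : ℕ) : L.T g (0, j + 1) =
    bern L.lam fun a => L.f * g (a.toNat, j) + (1 - L.f) * g (a.toNat, j + 1) := by
  have := L.sum_idle fun a r => g (a.toNat, bif r then j else j + 1)
  rw [T_apply]
  simp only [move]
  rw [this]
  simp only [bern, cond_true, cond_false]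

lemma T_empty (g : ℕ × ℕ → ℝ) : L.T g (0, 0) = bern L.lam fun a => g (a.toNat, 0) := by
  have := L.sum_idle fun a _ => g (a.toNat, 0)
  rw [T_apply]
  simp only [move]
  rw [this]
  simp only [bern]
  ring

/-- A quadratic polynomial in the queue lengths, without constant term. -/
def quad (A B C D E : ℝ) (y : ℕ × ℕ) : ℝ :=
  A * y.1 ^ 2 + B * (y.1 * y.2) + C * y.2 ^ 2 + D * y.1 + E * y.2

/-- Within each region the law of the increment does not depend on the state, so applying `T`
changes a quadratic polynomial by an affine function. Matching coefficients then settles the Poisson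
equations. -/
lemma T_quad_busy (A B C D E : ℝ) (i j : ℕ) : L.T (quad A B C D E) (i + 1, j) =
    quad A B C D E (i + 1, j) + A * (2 * (i + 1) * (L.lam - L.mu) + L.lam + L.mu
      - 2 * L.lam * L.mu) + B * (L.c * (i + 1) - L.mu * j + L.lam * j - L.c + L.lam * L.c)
      + C * (L.c * (2 * j + 1)) + D * (L.lam - L.mu) + E * L.c := by
  rw [T_busy]
  simp only [bern, quad, Bool.toNat, cond_true, cond_false, mu]
  push_cast
  ring

lemma T_quad_relay (A B C D E : ℝ) (j : ℕ) : L.T (quad A B C D E) (0, j + 1) =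
    quad A B C D E (0, j + 1) + A * L.lam + B * (L.lam * (j + 1 - L.f))
      + C * (L.f - 2 * L.f * (j + 1)) + D * L.lam - E * L.f := by
  rw [T_relay]
  simp only [bern, quad, Bool.toNat, cond_true, cond_false]
  push_cast
  ring

lemma T_quad_empty (A B C D E : ℝ) : L.T (quad A B C D E) (0, 0) =
    quad A B C D E (0, 0) + A * L.lam + D * L.lam := by
  rw [T_empty]
  simp only [bern, quad, Bool.toNat, cond_true, cond_false]
  push_cast
  ring

/-! ### Poisson equations -/

/-- Stationary mean length of the primary queue. -/
def meanPrimary : ℝ := L.lam * (1 - L.lam) / (L.mu - L.lam)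

/-- Stationary mean length of the relay queue. -/
def meanRelay : ℝ :=
  L.c * L.lam * (L.mu * (L.mu - L.lam) + (L.f + L.c) * L.lam * (1 - L.mu)) /
    (L.mu * (L.mu - L.lam) * (L.f * L.mu - L.lam * (L.f + L.c)))

/-- Stationary probability that both queues are empty. -/
def probEmpty : ℝ := (L.f * L.mu - L.lam * (L.f + L.c)) / (L.f * L.mu)

lemma probEmpty_pos : 0 < L.probEmpty := div_pos L.stable' (mul_pos L.f_pos L.mu_pos)

/-- `h` solves the Poisson equation for the function `g` with stationary mean `m`. -/
def IsPoisson (g : ℕ × ℕ → ℝ) (m : ℝ) (h : ℕ × ℕ → ℝ) : Prop := ∀ y, L.T h y = h y + m - g y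

/-- The primary queue evolves without regard to the relay queue, so only `A` and `D` are needed: the
coefficient of `i` in the busy region gives `A`, the empty state gives `D`, and the remaining
constant is the formula for the mean. -/
lemma exists_isPoisson_fst :
    ∃ A B C D E, L.IsPoisson (fun y => y.1) L.meanPrimary (quad A B C D E) := by
  have h1 := L.lam_pos.ne'
  have h2 := (sub_pos.2 L.lam_lt_mu).ne'
  refine ⟨1 / (2 * (L.mu - L.lam)), 0, 0,
    L.meanPrimary / L.lam - 1 / (2 * (L.mu - L.lam)), 0, ?_⟩
  rintro ⟨_ | i, _ | j⟩
  · rw [T_quad_empty, meanPrimary]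
    field_simp
    push_cast
    ring
  · rw [T_quad_relay, meanPrimary]
    field_simp
    push_cast
    ring
  · rw [T_quad_busy, meanPrimary]
    field_simp
    push_cast
    ring
  · rw [T_quad_busy, meanPrimary]
    field_simp
    push_cast
    ring

lemma exists_isPoisson_snd :
    ∃ A B C D E, L.IsPoisson (fun y => y.2) L.meanRelay (quad A B C D E) := by
  have h1 := L.lam_pos.ne'
  have h2 := (sub_pos.2 L.lam_lt_mu).ne'
  have h3 := L.f_pos.ne'
  have h4 := L.stable'.ne'
  have h5 := L.mu_pos.ne'
  -- Coefficient matching, in order: the empty state; the `j`-coefficient and the constant with only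
  -- the relay queue non-empty; the `i`-coefficient, the `j`-coefficient and the constant in the
  -- busy region. These six equations determine the five coefficients and the mean.
  have key : ∃ A B C D E : ℝ, A * L.lam + D * L.lam = L.meanRelay ∧ B * L.lam - 2 * L.f * C = -1 ∧
      E = C - B * L.lam ∧ 2 * A * (L.lam - L.mu) + B * L.c = 0 ∧
      B * (L.lam - L.mu) + 2 * L.c * C = -1 ∧
      A * (L.lam + L.mu - 2 * L.lam * L.mu) + B * (L.lam * L.c - L.c) + C * L.c
        + D * (L.lam - L.mu) + E * L.c = L.meanRelay := by
    -- Eliminating `C` from the two equations for the `j`-coefficients yields `B`, whose denominator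
    -- is the stability margin. `B` stays opaque, so that `field_simp` treats it as an atom until
    -- its value is needed.
    have hB : ∃ B, B = (L.c + L.f) / (L.f * L.mu - L.lam * (L.f + L.c)) := ⟨_, rfl⟩
    obtain ⟨B, hB⟩ := hB
    refine ⟨B * L.c / (2 * (L.mu - L.lam)), B, (1 + B * L.lam) / (2 * L.f),
      L.meanRelay / L.lam - B * L.c / (2 * (L.mu - L.lam)), _, ?_, ?_, rfl, ?_, ?_, ?_⟩
    · field_simp
      ring
    · field_simp
      ring
    · field_simp
      ring
    · rw [hB]
      field_simp
      ring
    · rw [meanRelay, hB]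
      field_simp
      ring
  obtain ⟨A, B, C, D, E, k1, k2, k3, k4, k5, k6⟩ := key
  refine ⟨A, B, C, D, E, ?_⟩
  rintro ⟨_ | i, _ | j⟩
  · rw [T_quad_empty]
    simp only [CharP.cast_eq_zero]
    linarith
  · rw [T_quad_relay]
    push_cast
    linear_combination k1 + (j + 1 : ℝ) * k2 - L.f * k3
  · rw [T_quad_busy]
    push_cast
    linear_combination (i + 1 : ℝ) * k4 + k6
  · rw [T_quad_busy]
    push_cast
    linear_combination (i + 1 : ℝ) * k4 + (j + 1 : ℝ) * k5 + k6

/-- Here `-h` is the expected remaining work: `1 / f` slots per relay packet and `1 / mu + (c / mu)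
/ f` per primary packet. Arrivals add `1 - probEmpty` per slot on average, and service removes one
unit on average unless both queues are empty. -/
lemma exists_isPoisson_empty :
    ∃ A B C D E, L.IsPoisson (fun y => if y = 0 then 1 else 0) L.probEmpty (quad A B C D E) := by
  have h3 := L.f_pos.ne'
  have h5 := L.mu_pos.ne'
  refine ⟨0, 0, 0, -((L.f + L.c) / (L.f * L.mu)), -(1 / L.f), ?_⟩
  rintro ⟨_ | i, _ | j⟩
  · rw [T_quad_empty, probEmpty]
    simp only [Prod.mk_zero_zero, if_true]
    field_simp
    ring
  · rw [T_quad_relay, probEmpty]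
    beta_reduce
    rw [if_neg (by simp [Prod.ext_iff])]
    field_simp
    ring
  · rw [T_quad_busy, probEmpty]
    beta_reduce
    rw [if_neg (by simp [Prod.ext_iff])]
    field_simp
    ring
  · rw [T_quad_busy, probEmpty]
    beta_reduce
    rw [if_neg (by simp [Prod.ext_iff])]
    field_simp
    ring

lemma quad_add (A B C D E A' B' C' D' E' : ℝ) : quad A B C D E + quad A' B' C' D' E' =
    quad (A + A') (B + B') (C + C') (D + D') (E + E') := by
  ext y
  simp only [quad, Pi.add_apply]
  ring

lemma IsPoisson.add {L : StableLaw} {g g' h h' : ℕ × ℕ → ℝ} {m m' : ℝ} (H : L.IsPoisson g m h)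
    (H' : L.IsPoisson g' m' h') : L.IsPoisson (fun y => g y + g' y) (m + m') (h + h') := fun y => by
  rw [map_add, Pi.add_apply, Pi.add_apply, H y, H' y]
  ring

end StableLaw

/-! ### A Lyapunov function -/

lemma abs_move_sub_le (y : ℕ × ℕ) (e : Outcome) :
    |((move y e).1 : ℝ) - y.1| ≤ 1 ∧ |((move y e).2 : ℝ) - y.2| ≤ 1 := by
  obtain ⟨i, j⟩ := y
  obtain ⟨a, d, c, r⟩ := e
  rcases i with _ | i <;> rcases j with _ | j <;> cases a <;> cases d <;> cases c <;> cases r <;>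
    simp [move, add_assoc] <;> norm_num

namespace StableLaw

variable (L : StableLaw)

/-- The drift of `α * i + j` is `c - α * (mu - lam)` when the primary queue is busy and `α * lam -
f` when only the relay queue is non-empty. Some `α` makes both negative because stability says `c /
(mu - lam) < f / lam`. -/
lemma exists_drift : ∃ α ε : ℝ, 0 < α ∧ 0 < ε ∧
    ∀ y, y ≠ 0 → L.T (quad 0 0 0 α 1) y ≤ quad 0 0 0 α 1 y - ε := by
  have hlam := L.lam_pos
  have hm : 0 < L.mu - L.lam := sub_pos.2 L.lam_lt_mu
  have hs := L.stable'
  have h1 : L.c / (L.mu - L.lam) < L.f / L.lam := by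
    rw [div_lt_div_iff₀ hm hlam]
    nlinarith
  obtain ⟨α, h2, h3⟩ := exists_between h1
  have h4 : L.c < α * (L.mu - L.lam) := (div_lt_iff₀ hm).1 h2
  have h5 : α * L.lam < L.f := (lt_div_iff₀ hlam).1 h3
  have h6 : 0 < α := (div_nonneg L.c_nonneg hm.le).trans_lt h2
  refine ⟨α, min (α * (L.mu - L.lam) - L.c) (L.f - α * L.lam), h6,
    lt_min (by linarith) (by linarith), ?_⟩
  have h7 := min_le_left (α * (L.mu - L.lam) - L.c) (L.f - α * L.lam)
  have h8 := min_le_right (α * (L.mu - L.lam) - L.c) (L.f - α * L.lam)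
  rintro ⟨_ | i, _ | j⟩ hy
  · exact absurd rfl hy
  · rw [T_quad_relay]
    linarith
  · rw [T_quad_busy]
    linarith
  · rw [T_quad_busy]
    linarith

/-- Jumps of the linear function are bounded, so expanding the exponential to second order lets the
negative linear drift dominate for small `θ`. -/
lemma exists_exp_drift : ∃ α θ ρ K : ℝ, 0 < α ∧ 0 < θ ∧ 0 ≤ ρ ∧ ρ < 1 ∧
    ∀ y, L.T (fun y => Real.exp (θ * quad 0 0 0 α 1 y)) y ≤
      ρ * Real.exp (θ * quad 0 0 0 α 1 y) + K := by
  obtain ⟨α, ε, hα, hε, hdrift⟩ := L.exists_drift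
  set V := quad 0 0 0 α 1 with hV
  -- The first bound keeps the exponents in `[-1, 1]`, where `|exp x - 1 - x| ≤ x ^ 2`; the second
  -- makes the quadratic remainder at most half the drift `θ * ε`.
  set θ := min (1 / (α + 1)) (ε / (2 * (α + 1) ^ 2)) with hθ
  have hB : 0 < α + 1 := by linarith
  have hθ0 : 0 < θ := lt_min (by positivity) (by positivity)
  have hθ1 : θ * (α + 1) ≤ 1 := (le_div_iff₀ hB).1 (min_le_left _ _)
  have hθ2 : θ * (2 * (α + 1) ^ 2) ≤ ε := (le_div_iff₀ (by positivity)).1 (min_le_right _ _)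
  have hjump : ∀ y e, |V (move y e) - V y| ≤ α + 1 := fun y e => by
    obtain ⟨h1, h2⟩ := abs_move_sub_le y e
    have : V (move y e) - V y = α * (((move y e).1 : ℝ) - y.1) + (((move y e).2 : ℝ) - y.2) := by
      simp only [hV, quad]
      ring
    rw [this]
    refine (abs_add_le _ _).trans ?_
    rw [abs_mul, abs_of_pos hα]
    nlinarith
  have hjump' : ∀ y e, |θ * (V (move y e) - V y)| ≤ 1 := fun y e => by
    rw [abs_mul, abs_of_pos hθ0]
    exact (mul_le_mul_of_nonneg_left (hjump y e) hθ0.le).trans hθ1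
  have hfac : ∀ y, L.T (fun y => Real.exp (θ * V y)) y =
      Real.exp (θ * V y) * ∑ e, L.weight e * Real.exp (θ * (V (move y e) - V y)) := fun y => by
    rw [T_apply, Finset.mul_sum]
    refine Finset.sum_congr rfl fun e _ => ?_
    rw [mul_left_comm, ← Real.exp_add]
    ring_nf
  have hbound : ∀ y, ∑ e, L.weight e * Real.exp (θ * (V (move y e) - V y)) ≤
      1 + θ * (L.T V y - V y) + θ ^ 2 * (α + 1) ^ 2 := fun y => by
    have : 1 + θ * (L.T V y - V y) + θ ^ 2 * (α + 1) ^ 2 = ∑ e, L.weight e *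
        (1 + θ * (V (move y e) - V y) + θ ^ 2 * (α + 1) ^ 2) := by
      simp only [mul_add, mul_sub, Finset.sum_add_distrib, Finset.sum_sub_distrib,
        ← Finset.sum_mul, L.sum_weight, T_apply, Finset.mul_sum, mul_left_comm θ]
      ring
    rw [this]
    refine Finset.sum_le_sum fun e _ => mul_le_mul_of_nonneg_left ?_ (L.weight_nonneg e)
    have h1 := (abs_le.1 (Real.abs_exp_sub_one_sub_id_le (hjump' y e))).2
    have h2 : (V (move y e) - V y) ^ 2 ≤ (α + 1) ^ 2 := sq_le_sq' (abs_le.1 (hjump y e)).1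
      (abs_le.1 (hjump y e)).2
    have h3 := mul_le_mul_of_nonneg_left h2 (sq_nonneg θ)
    rw [mul_pow] at h1
    linarith
  -- The maximum with `0` secures `0 ≤ ρ`. The constant `exp 1` is needed only at the empty state,
  -- where the exponential is `1` and grows in one step by a factor of at most `exp 1`.
  refine ⟨α, θ, max 0 (1 - θ * ε / 2), Real.exp 1, hα, hθ0, le_max_left _ _,
    max_lt one_pos (by linarith [mul_pos hθ0 hε]), fun y => ?_⟩
  rw [hfac]
  have hpos := Real.exp_pos (θ * V y)
  by_cases hy : y = 0
  · have h0 : V y = 0 := by simp [hy, hV, quad]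
    have : ∑ e, L.weight e * Real.exp (θ * (V (move y e) - V y)) ≤ Real.exp 1 := by
      have h1 : Real.exp 1 = ∑ e, L.weight e * Real.exp 1 := by
        rw [← Finset.sum_mul, L.sum_weight, one_mul]
      rw [h1]
      exact Finset.sum_le_sum fun e _ => mul_le_mul_of_nonneg_left
        (Real.exp_le_exp.2 (abs_le.1 (hjump' y e)).2) (L.weight_nonneg e)
    have h1 : Real.exp (θ * V y) = 1 := by rw [h0, mul_zero, Real.exp_zero]
    rw [h1, one_mul, mul_one]
    linarith [le_max_left 0 (1 - θ * ε / 2)]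
  · have h1 : 1 + θ * (L.T V y - V y) + θ ^ 2 * (α + 1) ^ 2 ≤ 1 - θ * ε / 2 := by
      have h2 := mul_le_mul_of_nonneg_left (hdrift y hy) hθ0.le
      have h3 := mul_le_mul_of_nonneg_left hθ2 hθ0.le
      linarith
    have h4 := ((hbound y).trans h1).trans (le_max_right 0 _)
    have h5 := mul_le_mul_of_nonneg_left h4 hpos.le
    have h6 := Real.exp_pos 1
    linarith

/-- Iterating the geometric drift bounds the exponential moments uniformly in time. Degree four is
what squares of quadratic Poisson solutions require. -/
lemma exists_lyapunov : ∃ W : ℕ × ℕ → ℝ, (∀ y, (1 + (y.1 : ℝ) + y.2) ^ 4 ≤ W y) ∧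
    ∀ y, ∃ B, ∀ n, (L.T ^ n) W y ≤ B := by
  obtain ⟨α, θ, ρ, K, hα, hθ, hρ0, hρ1, h⟩ := L.exists_exp_drift
  set W : ℕ × ℕ → ℝ := fun y => Real.exp (θ * quad 0 0 0 α 1 y) with hW
  set β := θ * min α 1 with hβ
  have hm : 0 < min α 1 := lt_min hα one_pos
  have hβ0 : 0 < β := mul_pos hθ hm
  -- From `x ^ 4 / 4! ≤ exp x` at `x = β * (1 + i + j)`.
  set C := 24 * Real.exp β / β ^ 4 with hC
  have hC0 : 0 < C := by positivity
  refine ⟨C • W, fun y => ?_, fun y => ?_⟩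
  · have h1 : β * (1 + (y.1 : ℝ) + y.2) ≤ β + θ * quad 0 0 0 α 1 y := by
      have h2 : min α 1 * (y.1 + y.2) ≤ α * y.1 + y.2 := by
        have h3 := mul_le_mul_of_nonneg_right (min_le_left α 1) (Nat.cast_nonneg (α := ℝ) y.1)
        have h4 := mul_le_mul_of_nonneg_right (min_le_right α 1) (Nat.cast_nonneg (α := ℝ) y.2)
        linarith
      have h5 := mul_le_mul_of_nonneg_left h2 hθ.le
      simp only [quad]
      rw [hβ]
      linarith
    have h6 := Real.pow_div_factorial_le_exp (x := β * (1 + (y.1 : ℝ) + y.2)) (by positivity) 4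
    have h7 : Real.exp (β * (1 + (y.1 : ℝ) + y.2)) ≤ Real.exp β * W y := by
      rw [hW, ← Real.exp_add]
      exact Real.exp_le_exp.2 h1
    have h8 : ((Nat.factorial 4 : ℕ) : ℝ) = 24 := by norm_num [Nat.factorial]
    rw [mul_pow, h8] at h6
    have h9 := h6.trans h7
    rw [div_le_iff₀ (by norm_num)] at h9
    rw [Pi.smul_apply, smul_eq_mul, hC, div_mul_eq_mul_div, le_div_iff₀ (by positivity)]
    linarith
  · have hstep : L.T W ≤ ρ • W + K • 1 := fun y => by simpa using h y
    have h0 : 0 ≤ W y := (Real.exp_pos _).le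
    have h1 : 0 ≤ |K| / (1 - ρ) := div_nonneg (abs_nonneg K) (by linarith)
    have h2 : ∀ n, (L.T ^ n) W y ≤ W y + |K| / (1 - ρ) := by
      intro n
      induction n with
      | zero => simpa using h1
      | succ n ih =>
        have h3 := L.T_pow_mono hstep n y
        rw [map_add, map_smul, map_smul, T_pow_one] at h3
        simp only [Pi.add_apply, Pi.smul_apply, smul_eq_mul, Pi.one_apply, mul_one] at h3
        rw [pow_succ, Module.End.mul_apply]
        have h4 := mul_le_mul_of_nonneg_left ih hρ0
        have h5 : |K| / (1 - ρ) * (1 - ρ) = |K| := div_mul_cancel₀ _ (by linarith)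
        have h6 : ρ * W y ≤ W y := mul_le_of_le_one_left h0 hρ1.le
        linarith [le_abs_self K]
    refine ⟨C * (W y + |K| / (1 - ρ)), fun n => ?_⟩
    rw [map_smul, Pi.smul_apply, smul_eq_mul]
    exact mul_le_mul_of_nonneg_left (h2 n) hC0.le

lemma exists_quad_sq_le (A B C D E : ℝ) :
    ∃ K, ∀ y, quad A B C D E y ^ 2 ≤ K * (1 + (y.1 : ℝ) + y.2) ^ 4 := by
  refine ⟨(|A| + |B| + |C| + |D| + |E|) ^ 2, fun y => ?_⟩
  have h : |quad A B C D E y| ≤ (|A| + |B| + |C| + |D| + |E|) * (1 + (y.1 : ℝ) + y.2) ^ 2 := by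
    have hi : (0 : ℝ) ≤ y.1 := Nat.cast_nonneg _
    have hj : (0 : ℝ) ≤ y.2 := Nat.cast_nonneg _
    set i : ℝ := ((y.1 : ℕ) : ℝ)
    set j : ℝ := ((y.2 : ℕ) : ℝ)
    have key : ∀ a x : ℝ, 0 ≤ x → x ≤ (1 + i + j) ^ 2 → |a * x| ≤ |a| * (1 + i + j) ^ 2 := by
      intro a x hx h
      rw [abs_mul, abs_of_nonneg hx]
      exact mul_le_mul_of_nonneg_left h (abs_nonneg a)
    have hij := mul_nonneg hi hj
    have h1 := key A (i ^ 2) (by positivity) (by nlinarith)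
    have h2 := key B (i * j) (by positivity) (by nlinarith)
    have h3 := key C (j ^ 2) (by positivity) (by nlinarith)
    have h4 := key D i hi (by nlinarith)
    have h5 := key E j hj (by nlinarith)
    have h6 : |quad A B C D E y| ≤
        |A * i ^ 2| + |B * (i * j)| + |C * j ^ 2| + |D * i| + |E * j| := by
      simp only [quad]
      refine (abs_add_le _ _).trans (add_le_add ((abs_add_le _ _).trans (add_le_add
        ((abs_add_le _ _).trans (add_le_add (abs_add_le _ _) le_rfl)) le_rfl)) le_rfl)
    linarith
  calc quad A B C D E y ^ 2 = |quad A B C D E y| ^ 2 := (sq_abs _).symm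
    _ ≤ ((|A| + |B| + |C| + |D| + |E|) * (1 + (y.1 : ℝ) + y.2) ^ 2) ^ 2 := by gcongr
    _ = _ := by ring

end StableLaw

/-! ### A law of large numbers for additive functionals -/

/-- By Tonelli the series of the `F k` has finite integral, so it converges almost everywhere and
its terms vanish. -/
lemma ae_tendsto_zero_of_summable_integral {Ω : Type*} [MeasurableSpace Ω] {P : Measure Ω}
    {F : ℕ → Ω → ℝ} (hF : ∀ k, Integrable (F k) P) (h0 : ∀ k ω, 0 ≤ F k ω)
    (hsum : Summable fun k => ∫ ω, F k ω ∂P) :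
    ∀ᵐ ω ∂P, Tendsto (fun k => F k ω) atTop (𝓝 0) := by
  have h1 : ∫⁻ ω, ∑' k, ENNReal.ofReal (F k ω) ∂P ≠ ⊤ := by
    rw [lintegral_tsum fun k => (hF k).aemeasurable.ennreal_ofReal]
    simp_rw [fun k => (ofReal_integral_eq_lintegral_ofReal (hF k) (.of_forall (h0 k))).symm]
    exact hsum.tsum_ofReal_ne_top
  filter_upwards [ae_lt_top' (AEMeasurable.tsum fun k =>
    (hF k).aemeasurable.ennreal_ofReal) h1] with ω hω
  have h2 := ENNReal.tendsto_atTop_zero_of_tsum_ne_top hω.ne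
  have h3 := (ENNReal.tendsto_toReal ENNReal.zero_ne_top).comp h2
  simpa [Function.comp_def, ENNReal.toReal_ofReal (h0 _ ω)] using h3

/-- Along the squares the second moments of `S n / n - m` are summable, which gives convergence
there. Monotonicity fills the gaps, since consecutive squares have ratio tending to `1`. -/
lemma ae_tendsto_div_of_integral_sq_le {Ω : Type*} [MeasurableSpace Ω] {P : Measure Ω}
    {S : ℕ → Ω → ℝ} {m A : ℝ} (hmono : ∀ ω, Monotone fun n => S n ω)
    (hint : ∀ n, Integrable (fun ω => (S n ω - n * m) ^ 2) P)
    (hA : ∀ n : ℕ, ∫ ω, (S n ω - n * m) ^ 2 ∂P ≤ A * (n + 1)) :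
    ∀ᵐ ω ∂P, Tendsto (fun n : ℕ => S n ω / n) atTop (𝓝 m) := by
  set c : ℕ → ℕ := fun k => (k + 1) ^ 2 with hc
  have hcpos : ∀ k, (0 : ℝ) < c k := fun k => by simp only [hc]; positivity
  have hone : Tendsto (fun k : ℕ => (c (k + 1) : ℝ) / c k) atTop (𝓝 1) := by
    have h1 : Tendsto (fun k : ℕ => (1 + 1 / ((k : ℝ) + 1)) ^ 2) atTop (𝓝 ((1 + 0) ^ 2)) :=
      (tendsto_one_div_add_atTop_nhds_zero_nat.const_add 1).pow 2
    rw [add_zero, one_pow] at h1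
    refine h1.congr fun k => ?_
    simp only [hc]
    push_cast
    field_simp
  have htop : Tendsto c atTop atTop :=
    (tendsto_pow_atTop two_ne_zero).comp (tendsto_add_atTop_nat 1)
  have hA0 : 0 ≤ A := by
    have := (integral_nonneg fun ω => sq_nonneg _).trans (hA 0)
    simpa using this
  have hsum : Summable fun k => ∫ ω, (S (c k) ω - c k * m) ^ 2 / (c k : ℝ) ^ 2 ∂P := by
    have h2 : Summable fun k : ℕ => 2 * A * (1 / ((k : ℝ) + 1) ^ 2) := by
      have := (summable_nat_add_iff 1).2 (Real.summable_one_div_nat_pow (p := 2)|>.2 one_lt_two)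
      push_cast at this
      exact this.mul_left _
    refine h2.of_nonneg_of_le (fun k => integral_nonneg fun ω => by positivity) fun k => ?_
    rw [integral_div]
    refine (div_le_div_of_nonneg_right (hA (c k)) (by positivity)).trans ?_
    have h3 : (1 : ℝ) ≤ c k := by exact_mod_cast Nat.one_le_pow _ _ k.succ_pos
    have h4 : A * ((c k : ℝ) + 1) / (c k : ℝ) ^ 2 ≤ 2 * A * (1 / c k) := by
      rw [div_le_iff₀ (by positivity)]
      have : 2 * A * (1 / (c k : ℝ)) * (c k : ℝ) ^ 2 = A * (2 * c k) := by
        have := (hcpos k).ne'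
        field_simp
      rw [this]
      exact mul_le_mul_of_nonneg_left (by linarith) hA0
    refine h4.trans (le_of_eq ?_)
    simp only [hc]
    push_cast
    rfl
  filter_upwards [ae_tendsto_zero_of_summable_integral (fun k => (hint (c k)).div_const _)
    (fun k ω => by positivity) hsum] with ω hω
  refine tendsto_div_of_monotone_of_exists_subseq_tendsto_div _ m (hmono ω) fun a ha =>
    ⟨c, ?_, htop, ?_⟩
  · filter_upwards [hone.eventually_lt_const ha] with k hk
    exact ((div_lt_iff₀ (hcpos k)).1 hk).le
  · have h5 : Tendsto (fun k => |S (c k) ω / c k - m|) atTop (𝓝 0) := by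
      have := (Real.continuous_sqrt.tendsto 0).comp hω
      rw [Real.sqrt_zero] at this
      refine this.congr fun k => ?_
      rw [Function.comp, ← div_pow, Real.sqrt_sq_eq_abs]
      congr 1
      have := (hcpos k).ne'
      field_simp
    exact tendsto_iff_norm_sub_tendsto_zero.2 h5

/-! ### Random walks driven by independent outcomes -/

section Driven

variable {Ω : Type*} [MeasurableSpace Ω] {P : Measure Ω} {X : ℕ → Ω → Outcome}

/-- Functions of finitely many outcomes live on a finite type. They are therefore measurable,
bounded and integrable without any growth condition. -/
lemma exists_factor {z : (ℕ → Outcome) → ℝ} {n : ℕ} (hz : DependsOn z (Set.Iio n)) :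
    ∃ z' : (Finset.range n → Outcome) → ℝ, ∀ x, z x = z' fun i => x i := by
  refine ⟨fun u => z fun m => if h : m ∈ Finset.range n then u ⟨m, h⟩ else default, fun x => ?_⟩
  refine hz fun i hi => ?_
  rw [dif_pos (Finset.mem_range.2 hi)]

/-- The outcomes are independent with law `L`. -/
structure IsDriving (L : StableLaw) (X : ℕ → Ω → Outcome) (P : Measure Ω) : Prop where
  measurable : ∀ n, Measurable (X n)
  indep : iIndepFun X P
  law : ∀ n e, P.real (X n ⁻¹' {e}) = L.weight e

variable {L : StableLaw}

lemma IsDriving.measurable_walk (H : IsDriving L X P) (y : ℕ × ℕ) (n : ℕ) :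
    Measurable fun ω => walk y (fun m => X m ω) n := by
  induction n with
  | zero => exact measurable_const
  | succ n ih =>
    exact (Measurable.of_discrete (f := fun u : (ℕ × ℕ) × Outcome => move u.1 u.2)).comp
      (ih.prodMk (H.measurable n))

variable [IsProbabilityMeasure P]

lemma integrable_of_dependsOn (hX : ∀ n, Measurable (X n)) {z : (ℕ → Outcome) → ℝ} {n : ℕ}
    (hz : DependsOn z (Set.Iio n)) : Integrable (fun ω => z fun m => X m ω) P := by
  obtain ⟨z', hz'⟩ := exists_factor hz
  simp_rw [hz']
  have hU : Measurable fun ω (i : Finset.range n) => X i ω :=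
    measurable_pi_lambda _ fun i => hX i
  exact (Integrable.of_finite (μ := P.map fun ω (i : Finset.range n) => X i ω)
    (f := z')).comp_measurable hU

lemma IsDriving.integral_mul_ite (H : IsDriving L X P) {z : (ℕ → Outcome) → ℝ} {n : ℕ}
    (hz : DependsOn z (Set.Iio n)) (e : Outcome) :
    ∫ ω, (z fun m => X m ω) * (if X n ω = e then 1 else 0) ∂P =
      (∫ ω, (z fun m => X m ω) ∂P) * L.weight e := by
  obtain ⟨z', hz'⟩ := exists_factor hz
  have h1 := H.indep.indepFun_finset (Finset.range n) {n} (by simp) H.measurable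
  have h2 : IndepFun (fun ω => z fun m => X m ω) (fun ω => if X n ω = e then (1 : ℝ) else 0) P := by
    simp_rw [hz']
    exact h1.comp (φ := z') (ψ := fun u : ({n} : Finset ℕ) → Outcome =>
      if u ⟨n, Finset.mem_singleton_self n⟩ = e then (1 : ℝ) else 0)
      (measurable_of_finite _) (measurable_of_finite _)
  have h3 : (fun ω => if X n ω = e then (1 : ℝ) else 0) = (X n ⁻¹' {e}).indicator 1 := by
    ext ω
    by_cases h : X n ω = e <;> simp [h]
  have h4 := H.measurable n (measurableSet_singleton e)
  rw [h2.integral_fun_mul_eq_mul_integral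
    (integrable_of_dependsOn H.measurable hz).aestronglyMeasurable
    (by rw [h3]; exact (measurable_one.indicator h4).aestronglyMeasurable), h3,
    integral_indicator_one h4, H.law]

lemma dependsOn_walk (y : ℕ × ℕ) (n : ℕ) : DependsOn (fun x => walk y x n) (Set.Iio n) :=
  fun _ _ h => walk_congr y h

/-- The Markov property, tested against a function `z` of the past: split according to the next
outcome, which is independent of `z` and of the current state. -/
lemma IsDriving.integral_mul_walk_succ (H : IsDriving L X P) {z : (ℕ → Outcome) → ℝ} {n : ℕ}
    (hz : DependsOn z (Set.Iio n)) (g : ℕ × ℕ → ℝ) (y : ℕ × ℕ) :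
    ∫ ω, (z fun m => X m ω) * g (walk y (fun m => X m ω) (n + 1)) ∂P =
      ∫ ω, (z fun m => X m ω) * L.T g (walk y (fun m => X m ω) n) ∂P := by
  have hz' : ∀ e, DependsOn (fun x => z x * g (move (walk y x n) e)) (Set.Iio n) := by
    intro e x x' h
    simp only [hz h, dependsOn_walk y n h]
  have h1 : ∀ ω, (z fun m => X m ω) * g (walk y (fun m => X m ω) (n + 1)) =
      ∑ e, (z fun m => X m ω) * g (move (walk y (fun m => X m ω) n) e) *
        (if X n ω = e then 1 else 0) := by
    intro ω
    simp [walk]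
  have h2 : ∀ ω, (z fun m => X m ω) * L.T g (walk y (fun m => X m ω) n) =
      ∑ e, (z fun m => X m ω) * g (move (walk y (fun m => X m ω) n) e) * L.weight e := by
    intro ω
    rw [StableLaw.T_apply, Finset.mul_sum]
    exact Finset.sum_congr rfl fun e _ => by ring
  simp_rw [h1, h2]
  rw [integral_finsetSum, integral_finsetSum]
  · refine Finset.sum_congr rfl fun e _ => ?_
    rw [H.integral_mul_ite (hz' e), integral_mul_const]
  · exact fun e _ => (integrable_of_dependsOn H.measurable (hz' e)).mul_const _
  · intro e _
    refine integrable_of_dependsOn (z := fun x => z x * g (move (walk y x n) e) *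
        (if x n = e then 1 else 0)) (n := n + 1) H.measurable fun x x' h => ?_
    have h' : ∀ i ∈ Set.Iio n, x i = x' i := fun i hi => h i (lt_trans hi n.lt_succ_self)
    simp only [hz h', dependsOn_walk y n h', h n n.lt_succ_self]

lemma IsDriving.integrable_walk (H : IsDriving L X P) (g : ℕ × ℕ → ℝ) (y : ℕ × ℕ) (n : ℕ) :
    Integrable (fun ω => g (walk y (fun m => X m ω) n)) P :=
  integrable_of_dependsOn (z := fun x => g (walk y x n)) (n := n) H.measurable fun x x' h => by
    simp only [dependsOn_walk y n h]

lemma IsDriving.integral_walk (H : IsDriving L X P) (g : ℕ × ℕ → ℝ) (y : ℕ × ℕ) (n : ℕ) :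
    ∫ ω, g (walk y (fun m => X m ω) n) ∂P = (L.T ^ n) g y := by
  induction n generalizing g with
  | zero => simp [walk]
  | succ n ih =>
    have := H.integral_mul_walk_succ (z := fun _ => 1) (n := n) (fun _ _ _ => rfl) g y
    simp only [one_mul] at this
    rw [this, ih, pow_succ, Module.End.mul_apply]

/-- Law of large numbers for an additive functional whose Poisson equation has a solution. -/
lemma IsDriving.ae_tendsto_average (H : IsDriving L X P) {g h : ℕ × ℕ → ℝ} {m K : ℝ}
    (hP : L.IsPoisson g m h) (hg0 : ∀ y, 0 ≤ g y)
    (hg : ∀ y, g y ^ 2 ≤ K * (1 + (y.1 : ℝ) + y.2) ^ 4)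
    (hh : ∀ y, h y ^ 2 ≤ K * (1 + (y.1 : ℝ) + y.2) ^ 4) (y : ℕ × ℕ) :
    ∀ᵐ ω ∂P, Tendsto
      (fun n : ℕ => (∑ k ∈ Finset.range n, g (walk y (fun m => X m ω) k)) / n) atTop (𝓝 m) := by
  obtain ⟨W, hW, hWB⟩ := L.exists_lyapunov
  obtain ⟨B, hB⟩ := hWB y
  have hK : 0 ≤ K := by
    have := (sq_nonneg _).trans (hg 0)
    simpa using this
  have hhW : ∀ y, h y ^ 2 ≤ K * W y := fun y =>
    (hh y).trans (mul_le_mul_of_nonneg_left (hW y) hK)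
  have hgW : ∀ y, g y ^ 2 ≤ K * W y := fun y =>
    (hg y).trans (mul_le_mul_of_nonneg_left (hW y) hK)
  have hW1 : ∀ n, ∫ ω, W (walk y (fun m => X m ω) n) ∂P ≤ B := fun n => by
    rw [H.integral_walk]
    exact hB n
  have hI := fun (g : ℕ × ℕ → ℝ) n => H.integrable_walk g y n
  have hhB : ∀ n, ∫ ω, h (walk y (fun m => X m ω) n) ^ 2 ∂P ≤ K * B := fun n => by
    refine (integral_mono (hI (fun y => h y ^ 2) n) ((hI W n).const_mul K) fun ω => hhW _).trans ?_
    rw [integral_const_mul]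
    exact mul_le_mul_of_nonneg_left (hW1 n) hK
  have hgB : ∀ n, ∫ ω, g (walk y (fun m => X m ω) n) ^ 2 ∂P ≤ K * B := fun n => by
    refine (integral_mono (hI (fun y => g y ^ 2) n) ((hI W n).const_mul K) fun ω => hgW _).trans ?_
    rw [integral_const_mul]
    exact mul_le_mul_of_nonneg_left (hW1 n) hK
  -- The Poisson equation makes `Q` a martingale along the walk; it differs from the centred sum
  -- only by `h` at the current state.
  set Q : ℕ → (ℕ → Outcome) → ℝ := fun n x =>
    ∑ k ∈ Finset.range n, g (walk y x k) - n * m + h (walk y x n) with hQ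
  have hwalk : ∀ {n k : ℕ} {x x' : ℕ → Outcome}, k ≤ n → (∀ i ∈ Set.Iio n, x i = x' i) →
      walk y x k = walk y x' k := fun hk hx => walk_congr y fun i hi => hx i (hi.trans_le hk)
  have hQdep : ∀ n, DependsOn (Q n) (Set.Iio n) := fun n x x' hx => by
    simp only [hQ]
    rw [hwalk le_rfl hx, Finset.sum_congr rfl fun k hk => by
      rw [hwalk (Finset.mem_range.1 hk).le hx]]
  have hsucc : ∀ n x, Q (n + 1) x = Q n x + (h (walk y x (n + 1)) - L.T h (walk y x n)) := by
    intro n x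
    simp only [hQ, Finset.sum_range_succ, hP _]
    push_cast
    ring
  -- Bounds the second moment of an increment `u - (v + m - w)`, through `2 * u ^ 2 + 6 * (v ^ 2 + m
  -- ^ 2 + w ^ 2)`.
  set D := 14 * (K * B) + 6 * m ^ 2 with hD
  have hstep : ∀ n, ∫ ω, Q (n + 1) (fun m => X m ω) ^ 2 ∂P ≤
      ∫ ω, Q n (fun m => X m ω) ^ 2 ∂P + D := by
    intro n
    have i1 : Integrable (fun ω => Q n (fun m => X m ω) ^ 2) P :=
      integrable_of_dependsOn (z := fun x => Q n x ^ 2) (n := n) H.measurable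
        fun x x' hx => by simp only [hQdep n hx]
    have i2 : Integrable (fun ω => Q n (fun m => X m ω) *
        h (walk y (fun m => X m ω) (n + 1))) P :=
      integrable_of_dependsOn (z := fun x => Q n x * h (walk y x (n + 1))) (n := n + 1)
        H.measurable fun x x' hx => by
          simp only [hQdep n fun i hi => hx i (lt_trans hi n.lt_succ_self), hwalk le_rfl hx]
    have i3 : Integrable (fun ω => Q n (fun m => X m ω) *
        L.T h (walk y (fun m => X m ω) n)) P :=
      integrable_of_dependsOn (z := fun x => Q n x * L.T h (walk y x n)) (n := n)
        H.measurable fun x x' hx => by simp only [hQdep n hx, hwalk le_rfl hx]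
    -- Orthogonality of martingale increments: this cancels the cross term in the square of `Q (n +
    -- 1)`.
    have e1 := H.integral_mul_walk_succ (hQdep n) h y
    have i4 := (hI (fun y => h y ^ 2) (n + 1)).const_mul 2
    have i5 := (hI (fun y => h y ^ 2) n).const_mul 6
    have i6 := (hI (fun y => g y ^ 2) n).const_mul 6
    have hle : ∀ ω, Q (n + 1) (fun m => X m ω) ^ 2 ≤ Q n (fun m => X m ω) ^ 2 +
        2 * (Q n (fun m => X m ω) * h (walk y (fun m => X m ω) (n + 1))
          - Q n (fun m => X m ω) * L.T h (walk y (fun m => X m ω) n)) +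
        (2 * h (walk y (fun m => X m ω) (n + 1)) ^ 2 +
          (6 * h (walk y (fun m => X m ω) n) ^ 2 +
          (6 * g (walk y (fun m => X m ω) n) ^ 2 + 6 * m ^ 2))) := by
      intro ω
      have hp := hP (walk y (fun m => X m ω) n)
      rw [hsucc]
      generalize L.T h (walk y (fun m => X m ω) n) = t at *
      generalize h (walk y (fun m => X m ω) (n + 1)) = u
      generalize h (walk y (fun m => X m ω) n) = v at *
      generalize g (walk y (fun m => X m ω) n) = w at *
      subst hp
      nlinarith [sq_nonneg (u + (v + m - w)), sq_nonneg (v - m), sq_nonneg (v + w),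
        sq_nonneg (m + w)]
    refine (integral_mono (integrable_of_dependsOn (z := fun x => Q (n + 1) x ^ 2) (n := n + 1)
        H.measurable fun x x' hx => by simp only [hQdep (n + 1) hx])
      ((i1.add ((i2.sub i3).const_mul 2)).add
        (i4.add (i5.add (i6.add (integrable_const (6 * m ^ 2)))))) hle).trans ?_
    simp only [Pi.add_apply, Pi.sub_apply]
    rw [integral_add, integral_add, integral_add, integral_add, integral_add, integral_const_mul,
      integral_sub i2 i3, e1, integral_const_mul, integral_const_mul, integral_const_mul]
    · simp only [integral_const, probReal_univ, one_smul]
      linarith [hhB n, hhB (n + 1), hgB n]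
    all_goals fun_prop
  have hQB : ∀ n : ℕ, ∫ ω, Q n (fun m => X m ω) ^ 2 ∂P ≤ h y ^ 2 + n * D := by
    intro n
    induction n with
    | zero => simp [hQ, walk]
    | succ n ih =>
      push_cast
      linarith [hstep n]
  have hSdep : ∀ n : ℕ, DependsOn
      (fun x => (∑ k ∈ Finset.range n, g (walk y x k) - n * m) ^ 2) (Set.Iio n) :=
    fun n x x' hx => by
      simp only
      rw [Finset.sum_congr rfl fun k hk => by rw [hwalk (Finset.mem_range.1 hk).le hx]]
  refine ae_tendsto_div_of_integral_sq_le (A := 2 * h y ^ 2 + 2 * D + 2 * (K * B)) (fun ω => ?_)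
    (fun n => integrable_of_dependsOn H.measurable (hSdep n)) fun n => ?_
  · refine monotone_nat_of_le_succ fun n => ?_
    rw [Finset.sum_range_succ]
    exact le_add_of_nonneg_right (hg0 _)
  · have i1 : Integrable (fun ω => 2 * Q n (fun m => X m ω) ^ 2) P :=
      integrable_of_dependsOn (z := fun x => 2 * Q n x ^ 2) (n := n) H.measurable
        fun x x' hx => by simp only [hQdep n hx]
    have i2 := (hI (fun y => h y ^ 2) n).const_mul 2
    refine (integral_mono (integrable_of_dependsOn H.measurable (hSdep n)) (i1.add i2)
      fun ω => ?_).trans ?_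
    · simp only [Pi.add_apply, hQ]
      generalize h (walk y (fun m => X m ω) n) = v
      generalize ∑ k ∈ Finset.range n, g (walk y (fun m => X m ω) k) - n * m = w
      nlinarith [sq_nonneg (w + 2 * v)]
    · simp only [Pi.add_apply]
      rw [integral_add i1 i2, integral_const_mul, integral_const_mul]
      have hKB : 0 ≤ K * B := (integral_nonneg fun ω => sq_nonneg _).trans (hhB 0)
      have hn : (0 : ℝ) ≤ n := Nat.cast_nonneg n
      have hD0 : 0 ≤ D := by positivity
      nlinarith [hQB n, hhB n, mul_nonneg hn (sq_nonneg (h y)), mul_nonneg hn hKB]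

end Driven

/-! ### Convergence in law -/

/-- Indicator function of a state. -/
def stateInd (q y : ℕ × ℕ) : ℝ := if y = q then 1 else 0

/-- Indicator function of the states above `q`. -/
def upperInd (q y : ℕ × ℕ) : ℝ := if q ≤ y then 1 else 0

lemma monotone_upperInd (q : ℕ × ℕ) : Monotone (upperInd q) := by
  intro y y' h
  simp only [upperInd]
  split_ifs with h1 h2
  · exact le_rfl
  · exact absurd (h1.trans h) h2
  · exact zero_le_one
  · exact le_rfl

/-- Inclusion-exclusion for quadrants. It reduces point masses to monotone functions, to which
stochastic monotonicity applies. -/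
lemma stateInd_eq (i j : ℕ) : stateInd (i, j) =
    upperInd (i, j) - upperInd (i + 1, j) - upperInd (i, j + 1) + upperInd (i + 1, j + 1) := by
  ext ⟨k, l⟩
  simp only [stateInd, upperInd, Pi.add_apply, Pi.sub_apply, Prod.mk_le_mk, Prod.mk.injEq,
    Nat.succ_le_iff]
  rcases lt_trichotomy k i with h1 | h1 | h1 <;> rcases lt_trichotomy l j with h2 | h2 | h2
  all_goals
    first | subst h1 | skip
    first | subst h2 | skip
    simp [*, ne_of_lt, ne_of_gt, le_of_lt, not_le_of_gt, not_lt_of_gt]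

namespace StableLaw

variable {L : StableLaw}

lemma abs_T_pow_le_of_sq_le {g W : ℕ × ℕ → ℝ} {K B : ℝ} {y : ℕ × ℕ} (hK : 0 ≤ K)
    (hg : ∀ y, g y ^ 2 ≤ K * W y) (hB : ∀ n, (L.T ^ n) W y ≤ B) (n : ℕ) :
    |(L.T ^ n) g y| ≤ K * B + 1 := by
  have h1 : g ≤ K • W + 1 := fun y => by
    simp only [Pi.add_apply, Pi.smul_apply, smul_eq_mul, Pi.one_apply]
    nlinarith [hg y, sq_nonneg (g y - 1 / 2)]
  have h2 : -g ≤ K • W + 1 := fun y => by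
    simp only [Pi.add_apply, Pi.smul_apply, smul_eq_mul, Pi.one_apply, Pi.neg_apply]
    nlinarith [hg y, sq_nonneg (g y + 1 / 2)]
  have h3 := L.T_pow_mono h1 n y
  have h4 := L.T_pow_mono h2 n y
  rw [map_add, map_smul, T_pow_one] at h3 h4
  rw [map_neg] at h4
  simp only [Pi.add_apply, Pi.smul_apply, smul_eq_mul, Pi.one_apply, Pi.neg_apply] at h3 h4
  have h5 := mul_le_mul_of_nonneg_left (hB n) hK
  exact abs_le.2 ⟨by linarith, by linarith⟩

/-- Started from empty queues, the expectation of a monotone function whose Poisson equation has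
a solution converges to the stationary mean. -/
lemma IsPoisson.tendsto {g h : ℕ × ℕ → ℝ} {m K : ℝ} (hP : L.IsPoisson g m h) (hmono : Monotone g)
    (hg : ∀ y, g y ^ 2 ≤ K * (1 + (y.1 : ℝ) + y.2) ^ 4)
    (hh : ∀ y, h y ^ 2 ≤ K * (1 + (y.1 : ℝ) + y.2) ^ 4) :
    Tendsto (fun n => (L.T ^ n) g 0) atTop (𝓝 m) := by
  obtain ⟨W, hW, hWB⟩ := L.exists_lyapunov
  obtain ⟨B, hB⟩ := hWB 0
  have hK : 0 ≤ K := by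
    have := (sq_nonneg _).trans (hg 0)
    simpa using this
  have hhB := abs_T_pow_le_of_sq_le hK
    (fun y => (hh y).trans (mul_le_mul_of_nonneg_left (hW y) hK)) hB
  have hgB := abs_T_pow_le_of_sq_le hK
    (fun y => (hg y).trans (mul_le_mul_of_nonneg_left (hW y) hK)) hB
  have h1 := tendsto_atTop_ciSup (L.monotone_T_pow_zero hmono)
    ⟨K * B + 1, by rintro _ ⟨n, rfl⟩; exact (abs_le.1 (hgB n)).2⟩
  have h2 : L.T h = h + m • 1 - g := by
    ext y
    simpa using hP y
  -- The Poisson equation telescopes; the boundary terms are bounded, so the Cesàro means tend to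
  -- `m`. The sequence itself converges by monotonicity, so its limit must be `m`.
  have h3 : ∀ n : ℕ, ∑ k ∈ Finset.range n, (L.T ^ k) g 0 = n * m + h 0 - (L.T ^ n) h 0 := by
    intro n
    induction n with
    | zero => simp
    | succ n ih =>
      rw [Finset.sum_range_succ, ih, pow_succ, Module.End.mul_apply, h2, map_sub, map_add,
        map_smul, T_pow_one]
      simp only [Pi.add_apply, Pi.sub_apply, Pi.smul_apply, smul_eq_mul, Pi.one_apply]
      push_cast
      ring
  have h4 : Tendsto (fun n : ℕ => (n : ℝ)⁻¹ * ∑ k ∈ Finset.range n, (L.T ^ k) g 0) atTop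
      (𝓝 m) := by
    have h5 : Tendsto (fun n : ℕ => (n : ℝ)⁻¹ * (h 0 - (L.T ^ n) h 0)) atTop (𝓝 0) := by
      refine squeeze_zero_norm (a := fun n : ℕ => (n : ℝ)⁻¹ * (|h 0| + (K * B + 1)))
        (fun n => ?_) ?_
      · rw [norm_mul, Real.norm_eq_abs, Real.norm_eq_abs, abs_of_nonneg (by positivity)]
        refine mul_le_mul_of_nonneg_left ((abs_sub _ _).trans ?_) (by positivity)
        linarith [hhB n]
      · simpa using tendsto_inv_atTop_nhds_zero_nat.mul_const (|h 0| + (K * B + 1))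
    have h6 := h5.const_add m
    rw [add_zero] at h6
    refine h6.congr' ?_
    filter_upwards [eventually_gt_atTop 0] with n hn
    have : (n : ℝ) ≠ 0 := by positivity
    rw [h3]
    field_simp
    ring
  rwa [tendsto_nhds_unique h1.cesaro h4] at h1

lemma exists_tendsto_stateInd (q : ℕ × ℕ) :
    ∃ r, Tendsto (fun n => (L.T ^ n) (stateInd q) 0) atTop (𝓝 r) := by
  have h : ∀ q, ∃ r, Tendsto (fun n => (L.T ^ n) (upperInd q) 0) atTop (𝓝 r) := fun q => by
    refine ⟨_, tendsto_atTop_ciSup (L.monotone_T_pow_zero (monotone_upperInd q)) ⟨1, ?_⟩⟩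
    rintro _ ⟨n, rfl⟩
    have : upperInd q ≤ 1 := fun y => by
      simp only [upperInd, Pi.one_apply]
      split_ifs <;> norm_num
    simpa [T_pow_one] using L.T_pow_mono this n 0
  obtain ⟨i, j⟩ := q
  obtain ⟨r1, h1⟩ := h (i, j)
  obtain ⟨r2, h2⟩ := h (i + 1, j)
  obtain ⟨r3, h3⟩ := h (i, j + 1)
  obtain ⟨r4, h4⟩ := h (i + 1, j + 1)
  refine ⟨_, (((h1.sub h2).sub h3).add h4).congr fun n => ?_⟩
  rw [stateInd_eq, map_add, map_sub, map_sub]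
  rfl

/-- Expectations of tight functions converge to expectations under the limit law. -/
lemma hasSum_of_tendsto {p : ℕ × ℕ → ℝ}
    (hp : ∀ q, Tendsto (fun n => (L.T ^ n) (stateInd q) 0) atTop (𝓝 (p q)))
    {g : ℕ × ℕ → ℝ} {l : ℝ} (hg0 : 0 ≤ g)
    (hg : ∀ y, g y * (1 + (y.1 : ℝ) + y.2) ≤ (1 + (y.1 : ℝ) + y.2) ^ 4)
    (hl : Tendsto (fun n => (L.T ^ n) g 0) atTop (𝓝 l)) :
    HasSum (fun q => p q * g q) l := by
  obtain ⟨W, hW, hWB⟩ := L.exists_lyapunov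
  obtain ⟨B, hB⟩ := hWB 0
  have hfin : ∀ F : Finset (ℕ × ℕ),
      Tendsto (fun n => (L.T ^ n) (∑ q ∈ F, g q • stateInd q) 0) atTop
        (𝓝 (∑ q ∈ F, p q * g q)) := fun F => by
    refine (tendsto_finsetSum F fun q _ => (hp q).mul_const (g q)).congr fun n => ?_
    rw [map_sum, Finset.sum_apply]
    refine Finset.sum_congr rfl fun q _ => ?_
    rw [map_smul, Pi.smul_apply, smul_eq_mul, mul_comm]
  have heval : ∀ (F : Finset (ℕ × ℕ)) y,
      (∑ q ∈ F, g q • stateInd q) y = if y ∈ F then g y else 0 := fun F y => by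
    rw [Finset.sum_apply]
    simp [stateInd]
  have hp0 : ∀ q, 0 ≤ p q * g q := fun q => by
    refine mul_nonneg (ge_of_tendsto' (hp q) fun n => ?_) (hg0 q)
    have : (0 : ℕ × ℕ → ℝ) ≤ stateInd q := fun y => by
      simp only [stateInd, Pi.zero_apply]
      split_ifs <;> norm_num
    simpa using L.T_pow_mono this n 0
  have hupper : ∀ F : Finset (ℕ × ℕ), ∑ q ∈ F, p q * g q ≤ l := fun F => by
    refine le_of_tendsto_of_tendsto' (hfin F) hl fun n => L.T_pow_mono (fun y => ?_) n 0
    rw [heval]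
    split_ifs
    · exact le_rfl
    · exact hg0 y
  have hsummable := summable_of_sum_le hp0 hupper
  -- Tightness: outside the box of side `R` the hypothesis on `g` gives `g ≤ W / (R + 1)`, so the
  -- truncation error is at most `B / (R + 1)` uniformly in `n`.
  have hlower : ∀ R : ℕ, l ≤ ∑' q, p q * g q + B * (1 / ((R : ℝ) + 1)) := fun R => by
    set F := Finset.Iic (R, R)
    have h1 : ∀ n, (L.T ^ n) g 0 ≤ (L.T ^ n) (∑ q ∈ F, g q • stateInd q) 0
        + B * (1 / ((R : ℝ) + 1)) := fun n => by
      have h2 : g ≤ ∑ q ∈ F, g q • stateInd q + (1 / ((R : ℝ) + 1)) • W := fun y => by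
        rw [Pi.add_apply, heval, Pi.smul_apply, smul_eq_mul]
        have hWy : 0 ≤ W y := le_trans (by positivity) (hW y)
        split_ifs with hy
        · exact le_add_of_nonneg_right (by positivity)
        · have h3 : (R : ℝ) + 1 ≤ 1 + y.1 + y.2 := by
            have h4 : ¬ (y.1 ≤ R ∧ y.2 ≤ R) := fun h => hy (Finset.mem_Iic.2 h)
            have h5 : R + 1 ≤ 1 + y.1 + y.2 := by omega
            exact_mod_cast h5
          rw [zero_add, one_div, ← div_eq_inv_mul, le_div_iff₀ (by positivity)]
          exact (mul_le_mul_of_nonneg_left h3 (hg0 y)).trans ((hg y).trans (hW y))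
      have h6 := L.T_pow_mono h2 n 0
      rw [map_add, map_smul, Pi.add_apply, Pi.smul_apply, smul_eq_mul] at h6
      have h7 := mul_le_mul_of_nonneg_right (hB n) (by positivity : 0 ≤ 1 / ((R : ℝ) + 1))
      linarith
    have h8 := le_of_tendsto_of_tendsto' hl ((hfin F).add_const _) h1
    linarith [hsummable.sum_le_tsum F fun q _ => hp0 q]
  have h9 : l ≤ ∑' q, p q * g q := by
    have h10 := (tendsto_one_div_add_atTop_nhds_zero_nat (𝕜 := ℝ)).const_mul B
    have h11 := h10.const_add (∑' q, p q * g q)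
    rw [mul_zero, add_zero] at h11
    exact ge_of_tendsto' h11 hlower
  have h12 := hsummable.hasSum
  rwa [le_antisymm (hsummable.tsum_le_of_sum_le hupper) h9] at h12

/-- The limit law of the queue lengths started from empty queues. -/
lemma exists_limit_law (L : StableLaw) : ∃ p : PMF (ℕ × ℕ),
    (∀ q, Tendsto (fun n => (L.T ^ n) (stateInd q) 0) atTop (𝓝 (p q).toReal)) ∧
    HasSum (fun q : ℕ × ℕ => (p q).toReal * q.1) L.meanPrimary ∧
    HasSum (fun q : ℕ × ℕ => (p q).toReal * q.2) L.meanRelay := by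
  choose p hp using L.exists_tendsto_stateInd
  have hp0 : ∀ q, 0 ≤ p q := fun q => by
    refine ge_of_tendsto' (hp q) fun n => ?_
    have : (0 : ℕ × ℕ → ℝ) ≤ stateInd q := fun y => by
      simp only [stateInd, Pi.zero_apply]
      split_ifs <;> norm_num
    simpa using L.T_pow_mono this n 0
  have hpoly : ∀ (y : ℕ × ℕ) (t : ℝ), t ≤ 1 + (y.1 : ℝ) + y.2 →
      t * (1 + (y.1 : ℝ) + y.2) ≤ (1 + (y.1 : ℝ) + y.2) ^ 4 := fun y t ht => by
    have h1 : (1 : ℝ) ≤ 1 + (y.1 : ℝ) + y.2 := by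
      have := Nat.cast_nonneg (α := ℝ) y.1
      have := Nat.cast_nonneg (α := ℝ) y.2
      linarith
    calc t * (1 + (y.1 : ℝ) + y.2) ≤ (1 + (y.1 : ℝ) + y.2) * (1 + (y.1 : ℝ) + y.2) :=
          mul_le_mul_of_nonneg_right ht (by linarith)
      _ = (1 + (y.1 : ℝ) + y.2) ^ 2 := by ring
      _ ≤ _ := pow_le_pow_right₀ h1 (by norm_num)
  have hsq : ∀ (y : ℕ × ℕ) (t : ℝ), 0 ≤ t → t ≤ 1 + (y.1 : ℝ) + y.2 →
      t ^ 2 ≤ (1 + (y.1 : ℝ) + y.2) ^ 4 := fun y t h0 ht => by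
    refine le_trans ?_ (hpoly y t ht)
    nlinarith
  have hmean : ∀ (g : ℕ × ℕ → ℝ) (m : ℝ), 0 ≤ g → Monotone g →
      (∀ y, g y ≤ 1 + (y.1 : ℝ) + y.2) → (∃ A B C D E, L.IsPoisson g m (quad A B C D E)) →
      HasSum (fun q => p q * g q) m := by
    rintro g m h0 hmono hg ⟨A, B, C, D, E, hP⟩
    obtain ⟨K, hK⟩ := exists_quad_sq_le A B C D E
    refine hasSum_of_tendsto hp h0 (fun y => hpoly y _ (hg y)) (hP.tendsto (K := max K 1) hmono
      (fun y => ?_) fun y => (hK y).trans ?_)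
    · refine (hsq y _ (h0 y) (hg y)).trans (le_mul_of_one_le_left (by positivity)
        (le_max_right _ _))
    · exact mul_le_mul_of_nonneg_right (le_max_left _ _) (by positivity)
  -- The same tightness with `g = 1` shows that no mass escapes to infinity.
  have hone : HasSum p 1 := by
    have := hasSum_of_tendsto hp (g := 1) (l := 1) zero_le_one (fun y => hpoly y _ ?_) ?_
    · simpa using this
    · have := Nat.cast_nonneg (α := ℝ) y.1
      have := Nat.cast_nonneg (α := ℝ) y.2
      simp only [Pi.one_apply]
      linarith
    · simp [T_pow_one]
  refine ⟨⟨fun q => ENNReal.ofReal (p q), ?_⟩, fun q => ?_, ?_, ?_⟩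
  · rw [← ENNReal.ofReal_one, ← hone.tsum_eq, ENNReal.ofReal_tsum_of_nonneg hp0 hone.summable]
    exact ENNReal.summable.hasSum
  · change Tendsto _ _ (𝓝 (ENNReal.ofReal (p q)).toReal)
    rw [ENNReal.toReal_ofReal (hp0 q)]
    exact hp q
  · change HasSum (fun q : ℕ × ℕ => (ENNReal.ofReal (p q)).toReal * q.1) _
    simp_rw [fun q => ENNReal.toReal_ofReal (hp0 q)]
    refine hmean _ _ (fun y => Nat.cast_nonneg _) (fun y y' h => Nat.cast_le.2 h.1) (fun y => ?_)
      L.exists_isPoisson_fst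
    have := Nat.cast_nonneg (α := ℝ) y.2
    linarith
  · change HasSum (fun q : ℕ × ℕ => (ENNReal.ofReal (p q)).toReal * q.2) _
    simp_rw [fun q => ENNReal.toReal_ofReal (hp0 q)]
    refine hmean _ _ (fun y => Nat.cast_nonneg _) (fun y y' h => Nat.cast_le.2 h.2) (fun y => ?_)
      L.exists_isPoisson_snd
    have := Nat.cast_nonneg (α := ℝ) y.1
    linarith

end StableLaw

/-! ### Almost sure behaviour -/

/-- If `v` failed from `n` on, the partial sums would be eventually constant and the averages would
tend to `0`. -/
lemma exists_ge_of_tendsto_average {v : ℕ → Prop} [DecidablePred v] {r : ℝ} (hr : 0 < r)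
    (h : Tendsto (fun n : ℕ => (∑ k ∈ Finset.range n, if v k then (1 : ℝ) else 0) / n) atTop (𝓝 r))
    (n : ℕ) : ∃ m ≥ n, v m := by
  by_contra! hv
  have h1 : ∀ m ≥ n, ∑ k ∈ Finset.range m, (if v k then (1 : ℝ) else 0) =
      ∑ k ∈ Finset.range n, if v k then (1 : ℝ) else 0 := fun m hm => by
    induction m, hm using Nat.le_induction with
    | base => rfl
    | succ m hm ih => rw [Finset.sum_range_succ, ih, if_neg (hv m hm), add_zero]
  have h2 : Tendsto (fun m : ℕ => (∑ k ∈ Finset.range m, if v k then (1 : ℝ) else 0) / m) atTop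
      (𝓝 0) := by
    refine (tendsto_const_div_atTop_nhds_zero_nat
      (∑ k ∈ Finset.range n, if v k then (1 : ℝ) else 0)).congr' ?_
    filter_upwards [eventually_ge_atTop n] with m hm
    rw [h1 m hm]
  exact hr.ne (tendsto_nhds_unique h2 h)

section Driven

variable {Ω : Type*} [MeasurableSpace Ω] {P : Measure Ω} {X : ℕ → Ω → Outcome}
  [IsProbabilityMeasure P] {L : StableLaw}

lemma IsDriving.ae_tendsto_length (H : IsDriving L X P) (y : ℕ × ℕ) : ∀ᵐ ω ∂P, Tendsto
    (fun n : ℕ => (∑ k ∈ Finset.range n, (((walk y (fun m => X m ω) k).1 : ℝ) +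
      (walk y (fun m => X m ω) k).2)) / n) atTop (𝓝 (L.meanPrimary + L.meanRelay)) := by
  obtain ⟨A, B, C, D, E, h1⟩ := L.exists_isPoisson_fst
  obtain ⟨A', B', C', D', E', h2⟩ := L.exists_isPoisson_snd
  have h3 := h1.add h2
  rw [StableLaw.quad_add] at h3
  obtain ⟨K, hK⟩ := StableLaw.exists_quad_sq_le (A + A') (B + B') (C + C') (D + D') (E + E')
  refine H.ae_tendsto_average (K := max K 1) h3 (fun y => by positivity) (fun y => ?_)
    (fun y => (hK y).trans (mul_le_mul_of_nonneg_right (le_max_left _ _) (by positivity))) y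
  have hi := Nat.cast_nonneg (α := ℝ) y.1
  have hj := Nat.cast_nonneg (α := ℝ) y.2
  calc ((y.1 : ℝ) + y.2) ^ 2 ≤ (1 + (y.1 : ℝ) + y.2) ^ 2 :=
        pow_le_pow_left₀ (by positivity) (by linarith) 2
    _ ≤ (1 + (y.1 : ℝ) + y.2) ^ 4 := pow_le_pow_right₀ (by linarith) (by norm_num)
    _ ≤ _ := le_mul_of_one_le_left (by positivity) (le_max_right _ _)

lemma IsDriving.ae_tendsto_empty (H : IsDriving L X P) (y : ℕ × ℕ) : ∀ᵐ ω ∂P, Tendsto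
    (fun n : ℕ => (∑ k ∈ Finset.range n,
      if walk y (fun m => X m ω) k = 0 then (1 : ℝ) else 0) / n) atTop (𝓝 L.probEmpty) := by
  obtain ⟨A, B, C, D, E, h⟩ := L.exists_isPoisson_empty
  obtain ⟨K, hK⟩ := StableLaw.exists_quad_sq_le A B C D E
  refine H.ae_tendsto_average (K := max K 1) h (fun y => ?_) (fun y => ?_)
    (fun y => (hK y).trans (mul_le_mul_of_nonneg_right (le_max_left _ _) (by positivity))) y
  · split_ifs <;> norm_num
  · have hi := Nat.cast_nonneg (α := ℝ) y.1
    have hj := Nat.cast_nonneg (α := ℝ) y.2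
    calc (if y = 0 then (1 : ℝ) else 0) ^ 2 ≤ 1 := by split_ifs <;> norm_num
      _ ≤ (1 + (y.1 : ℝ) + y.2) ^ 4 := one_le_pow₀ (by linarith)
      _ ≤ _ := le_mul_of_one_le_left (by positivity) (le_max_right _ _)

/-- Couple with the walk from empty queues under the same outcomes. The two agree once the larger
has been empty, which almost surely happens, and dominated convergence turns this into equality of
the limits. -/
lemma IsDriving.tendsto_law (H : IsDriving L X P) (y : ℕ × ℕ) (q : ℕ × ℕ) {r : ℝ}
    (hr : Tendsto (fun n => (L.T ^ n) (stateInd q) 0) atTop (𝓝 r)) :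
    Tendsto (fun n => P.real {ω | walk y (fun m => X m ω) n = q}) atTop (𝓝 r) := by
  have h1 : ∀ n, P.real {ω | walk y (fun m => X m ω) n = q} =
      ∫ ω, stateInd q (walk y (fun m => X m ω) n) ∂P := fun n => by
    have hm := H.measurable_walk y n (measurableSet_singleton q)
    change P.real ((fun ω => walk y (fun m => X m ω) n) ⁻¹' {q}) = _
    rw [← integral_indicator_one hm]
    congr 1
    ext ω
    by_cases h : walk y (fun m => X m ω) n = q <;> simp [stateInd, h]
  have h2 : Tendsto (fun n => ∫ ω, (stateInd q (walk y (fun m => X m ω) n)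
      - stateInd q (walk 0 (fun m => X m ω) n)) ∂P) atTop (𝓝 (∫ _, (0 : ℝ) ∂P)) := by
    refine tendsto_integral_of_dominated_convergence (fun _ => 1) (fun n =>
      ((H.integrable_walk _ y n).sub (H.integrable_walk _ 0 n)).aestronglyMeasurable)
      (integrable_const 1) (fun n => .of_forall fun ω => ?_) ?_
    · simp only [stateInd]
      split_ifs <;> norm_num
    · filter_upwards [H.ae_tendsto_empty y] with ω hω
      obtain ⟨m, -, hm⟩ := exists_ge_of_tendsto_average L.probEmpty_pos hω 0
      refine tendsto_const_nhds.congr' ?_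
      filter_upwards [eventually_ge_atTop m] with n hn
      rw [walk_eq_of_walk_eq_zero (zero_le : (0 : ℕ × ℕ) ≤ y) hm hn, sub_self]
  rw [integral_zero] at h2
  have h3 := h2.add hr
  rw [zero_add] at h3
  refine h3.congr fun n => ?_
  rw [h1, integral_sub (H.integrable_walk _ y n) (H.integrable_walk _ 0 n),
    H.integral_walk _ 0 n, sub_add_cancel]

end Driven

/-! ### Little's law -/

/-- Number of occurrences `I m k` of packet `k` in a system at time `m`, for packets that enter
one by one and never return; `r m` further packets are present at time `m`. -/
structure IsOccupancy (I : ℕ → ℕ → ℕ) (r : ℕ → ℕ) : Prop where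
  le_one : ∀ m k, I m k ≤ 1
  eq_zero : ∀ m k, m ≤ k → I m k = 0
  anti : ∀ m k, k < m → I (m + 1) k ≤ I m k
  rest_anti : Antitone r

namespace IsOccupancy

variable {I : ℕ → ℕ → ℕ} {r : ℕ → ℕ}

lemma eq_zero_of_empty (H : IsOccupancy I r) {t : ℕ} (ht : r t + ∑ k ∈ Finset.range t, I t k = 0)
    {m k : ℕ} (hk : k < t) (hm : t ≤ m) : I m k = 0 := by
  induction m, hm using Nat.le_induction with
  | base =>
    have h1 := Finset.single_le_sum (f := I t) (fun _ _ => Nat.zero_le _) (Finset.mem_range.2 hk)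
    omega
  | succ m hm ih =>
    have := H.anti m k (hk.trans_le hm)
    omega

lemma finite (H : IsOccupancy I r) {t k : ℕ} (ht : r t + ∑ k ∈ Finset.range t, I t k = 0)
    (hk : k < t) : {m | I m k ≠ 0}.Finite :=
  (Finset.range t).finite_toSet.subset fun m hm => by
    by_contra h
    exact hm (H.eq_zero_of_empty ht hk (by simpa using h))

lemma ncard_eq (H : IsOccupancy I r) {t k : ℕ} (ht : r t + ∑ k ∈ Finset.range t, I t k = 0)
    (hk : k < t) : {m | I m k ≠ 0}.ncard = ∑ m ∈ Finset.range t, I m k := by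
  have h1 : {m | I m k ≠ 0} = ((Finset.range t).filter fun m => I m k ≠ 0 : Finset ℕ) := by
    ext m
    simp only [Set.mem_ofPred_eq, Finset.coe_filter, Finset.mem_range, iff_and_self]
    intro hm
    by_contra! h
    exact hm (H.eq_zero_of_empty ht hk h)
  rw [h1, Set.ncard_coe_finset, Finset.card_filter]
  refine Finset.sum_congr rfl fun m _ => ?_
  have := H.le_one m k
  split_ifs with h <;> omega

/-- At the empty time `t` every packet labelled below `n` has left, so the delays are sums over
slots before `t`. Exchange the sums and drop packets that have not yet arrived. -/
lemma sum_ncard_le (H : IsOccupancy I r) {n t : ℕ}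
    (ht : r t + ∑ k ∈ Finset.range t, I t k = 0) (hn : n ≤ t) :
    ∑ k ∈ Finset.range n, {m | I m k ≠ 0}.ncard ≤
      ∑ m ∈ Finset.range t, (r m + ∑ k ∈ Finset.range m, I m k) := by
  rw [Finset.sum_congr rfl fun k hk => H.ncard_eq ht ((Finset.mem_range.1 hk).trans_le hn),
    Finset.sum_comm]
  refine Finset.sum_le_sum fun m _ => le_add_left ?_
  rcases le_total n m with h | h
  · exact Finset.sum_le_sum_of_subset (Finset.range_subset_range.2 h)
  · rw [← Finset.sum_range_add_sum_Ico _ h, Finset.sum_eq_zero (s := Finset.Ico m n), add_zero]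
    exact fun k hk => H.eq_zero m k (Finset.mem_Ico.1 hk).1

/-- Labelled packets present before time `n` all carry labels below `n`. The unlabelled ones are
gone from `t₀` on, so they cost an amount independent of `n`. -/
lemma le_sum_ncard (H : IsOccupancy I r) {n t₀ t : ℕ}
    (ht₀ : r t₀ + ∑ k ∈ Finset.range t₀, I t₀ k = 0)
    (ht : r t + ∑ k ∈ Finset.range t, I t k = 0) (hn : n ≤ t) :
    ∑ m ∈ Finset.range n, (r m + ∑ k ∈ Finset.range m, I m k) ≤
      ∑ k ∈ Finset.range n, {m | I m k ≠ 0}.ncard + ∑ m ∈ Finset.range t₀, r m := by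
  rw [Finset.sum_congr rfl fun k hk => H.ncard_eq ht ((Finset.mem_range.1 hk).trans_le hn),
    Finset.sum_comm, Finset.sum_add_distrib, add_comm]
  refine add_le_add ?_ ?_
  · refine (Finset.sum_le_sum fun m hm => ?_).trans
      (Finset.sum_le_sum_of_subset (Finset.range_subset_range.2 hn))
    exact Finset.sum_le_sum_of_subset (Finset.range_subset_range.2 (Finset.mem_range.1 hm).le)
  · rcases le_total n t₀ with h | h
    · exact Finset.sum_le_sum_of_subset (Finset.range_subset_range.2 h)
    · rw [← Finset.sum_range_add_sum_Ico _ h, Finset.sum_eq_zero (s := Finset.Ico t₀ n), add_zero]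
      intro m hm
      have := H.rest_anti (Finset.mem_Ico.1 hm).1
      omega

/-- Little's law. -/
lemma tendsto_sum_ncard (H : IsOccupancy I r) {len : ℕ → ℕ}
    (hlen : ∀ m, len m = r m + ∑ k ∈ Finset.range m, I m k) {l u : ℝ} (hu : 0 < u)
    (hl : Tendsto (fun n : ℕ => (∑ m ∈ Finset.range n, (len m : ℝ)) / n) atTop (𝓝 l))
    (he : Tendsto (fun n : ℕ => (∑ m ∈ Finset.range n, if len m = 0 then (1 : ℝ) else 0) / n)
      atTop (𝓝 u)) :
    (∀ k, {m | I m k ≠ 0}.Finite) ∧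
    Tendsto (fun n : ℕ => (∑ k ∈ Finset.range n, ({m | I m k ≠ 0}.ncard : ℝ)) / n) atTop
      (𝓝 l) := by
  have hex := exists_ge_of_tendsto_average hu he
  have hempty : ∀ {t}, len t = 0 → r t + ∑ k ∈ Finset.range t, I t k = 0 := fun h => by
    rw [← hlen, h]
  refine ⟨fun k => ?_, ?_⟩
  · obtain ⟨t, ht, h0⟩ := hex (k + 1)
    exact H.finite (hempty h0) ht
  -- The first empty time from `n` on.
  set τ : ℕ → ℕ := fun n => Nat.find (hex n) with hτ
  have hτge : ∀ n, n ≤ τ n := fun n => (Nat.find_spec (hex n)).1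
  have hτ0 : ∀ n, len (τ n) = 0 := fun n => (Nat.find_spec (hex n)).2
  have hτmin : ∀ n, ∑ m ∈ Finset.range (τ n), (if len m = 0 then (1 : ℝ) else 0) =
      ∑ m ∈ Finset.range n, if len m = 0 then (1 : ℝ) else 0 := fun n => by
    rw [← Finset.sum_range_add_sum_Ico _ (hτge n), add_eq_left]
    refine Finset.sum_eq_zero fun m hm => if_neg fun h0 => ?_
    exact Nat.find_min (hex n) (Finset.mem_Ico.1 hm).2 ⟨(Finset.mem_Ico.1 hm).1, h0⟩
  have hτtop : Tendsto τ atTop atTop := tendsto_atTop_mono hτge tendsto_id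
  -- There is no empty slot in `[n, τ n)`, so the empty slots before `n` and before `τ n` are
  -- equally many. These counts are asymptotic to `u * n` and `u * τ n`, with `u` positive.
  have hratio : Tendsto (fun n : ℕ => (τ n : ℝ) / n) atTop (𝓝 1) := by
    have h1 := he.div (he.comp hτtop) hu.ne'
    rw [div_self hu.ne'] at h1
    refine h1.congr' ?_
    filter_upwards [he.eventually_const_lt hu, eventually_gt_atTop 0] with n hn hn0
    simp only [Pi.div_apply, Function.comp_apply, hτmin]
    have h2 : (n : ℝ) ≠ 0 := by positivity
    have h3 : ((τ n : ℕ) : ℝ) ≠ 0 := by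
      have := hτge n
      have : 0 < τ n := by omega
      positivity
    have h4 : (∑ m ∈ Finset.range n, if len m = 0 then (1 : ℝ) else 0) ≠ 0 := fun h => by
      rw [h, zero_div] at hn
      exact hn.false
    field_simp
  obtain ⟨t₀, -, ht₀⟩ := hex 0
  have hlow : Tendsto (fun n : ℕ => (∑ m ∈ Finset.range n, (len m : ℝ)) / n
      - ((∑ m ∈ Finset.range t₀, r m : ℕ) : ℝ) / n) atTop (𝓝 l) := by
    simpa using hl.sub (tendsto_const_div_atTop_nhds_zero_nat _)
  have hupp : Tendsto (fun n : ℕ => (∑ m ∈ Finset.range (τ n), (len m : ℝ)) / n) atTop (𝓝 l) := by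
    have h1 := (hl.comp hτtop).mul hratio
    rw [mul_one] at h1
    refine h1.congr' ?_
    filter_upwards [eventually_gt_atTop 0] with n hn0
    have h3 : ((τ n : ℕ) : ℝ) ≠ 0 := by
      have := hτge n
      have : 0 < τ n := by omega
      positivity
    simp only [Function.comp_apply]
    field_simp
  refine tendsto_of_tendsto_of_tendsto_of_le_of_le hlow hupp (fun n => ?_) fun n => ?_
  · have h1 := H.le_sum_ncard (hempty ht₀) (hempty (hτ0 n)) (hτge n)
    simp_rw [← hlen] at h1
    have h2 : (∑ m ∈ Finset.range n, (len m : ℝ)) ≤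
        ∑ k ∈ Finset.range n, ({m | I m k ≠ 0}.ncard : ℝ)
          + ((∑ m ∈ Finset.range t₀, r m : ℕ) : ℝ) := by exact_mod_cast h1
    simp only
    rw [← sub_div]
    exact div_le_div_of_nonneg_right (by linarith) (Nat.cast_nonneg n)
  · have h1 := H.sum_ncard_le (hempty (hτ0 n)) (hτge n)
    simp_rw [← hlen] at h1
    have h2 : ∑ k ∈ Finset.range n, ({m | I m k ≠ 0}.ncard : ℝ) ≤
        ∑ m ∈ Finset.range (τ n), (len m : ℝ) := by exact_mod_cast h1
    exact div_le_div_of_nonneg_right h2 (Nat.cast_nonneg n)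

end IsOccupancy

/-! ### The contents of the queues -/

namespace Network

variable {S : Network}

open Classical in
/-- The outcome of a slot. -/
def outcome (π : Policy S) (x : S.Slot) : Outcome :=
  (x.1, decide (S.directSuccess x), decide (S.clusterSuccess x), decide (S.relaySuccess π x))

lemma lengths_eq_walk (π : Policy S) (a b : ℕ) (x : ℕ → S.Slot) (n : ℕ) :
    S.lengths π a b x n = walk (a, b) (fun m => outcome π (x m)) n := by
  induction n with
  | zero => simp [lengths, queues, walk]
  | succ n ih =>
    rw [walk, ← ih]
    simp only [lengths, queues]
    generalize S.queues π a b x n = Q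
    obtain ⟨_ | ⟨k, q⟩, _ | ⟨l, q'⟩⟩ := Q <;> by_cases ha : (x n).1 <;>
      by_cases hd : S.directSuccess (x n) <;> by_cases hc : S.clusterSuccess (x n) <;>
      by_cases hr : S.relaySuccess π (x n) <;>
      simp [serve, move, outcome, Slot.arrival, ha, hd, hc, hr]

/-- Number of copies of a packet in the two queues at the beginning of slot `m`. -/
def copies (π : Policy S) (a b : ℕ) (x : ℕ → S.Slot) (m : ℕ) (o : Option ℕ) : ℕ :=
  ((S.queues π a b x m).1 ++ (S.queues π a b x m).2).count o

lemma count_serve_le (π : Policy S) (x : S.Slot) (Q : Queues) (o : Option ℕ) :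
    ((S.serve π x Q).1 ++ (S.serve π x Q).2).count o ≤ (Q.1 ++ Q.2).count o := by
  obtain ⟨_ | ⟨k, q⟩, _ | ⟨l, q'⟩⟩ := Q <;> simp only [serve]
  · exact le_rfl
  all_goals
    split_ifs <;> simp only [List.count_cons, List.count_append, List.count_nil] <;> omega

-- Service can only move or remove a packet, and the label `some m` is created only by an arrival in
-- slot `m`. All the occupancy axioms follow from this one inequality.
open Classical in
lemma copies_succ_le (π : Policy S) (a b : ℕ) (x : ℕ → S.Slot) (m : ℕ) (o : Option ℕ) :
    copies π a b x (m + 1) o ≤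
      copies π a b x m o + if o = some m ∧ (x m).arrival then 1 else 0 := by
  have h := count_serve_le π (x m) (S.queues π a b x m) o
  simp only [copies, queues]
  refine le_trans ?_ (add_le_add_left h _)
  by_cases ha : (x m).arrival
  · by_cases ho : o = some m
    · simp only [ha, ho, List.count_append, if_true, and_self, List.count_singleton_self]
      omega
    · have : [some m].count o = 0 := List.count_eq_zero.2 (by simpa using ho)
      simp only [ha, List.count_append, if_true, this]
      omega
  · simp only [ha, if_false]
    omega

lemma copies_some_eq_zero (π : Policy S) (a b : ℕ) (x : ℕ → S.Slot) {m k : ℕ} (h : m ≤ k) :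
    copies π a b x m (some k) = 0 := by
  induction m with
  | zero => simp [copies, queues, List.count_eq_zero]
  | succ m ih =>
    have h1 := copies_succ_le π a b x m (some k)
    rw [ih (by omega), if_neg (by simp; omega)] at h1
    omega

lemma copies_some_le_one (π : Policy S) (a b : ℕ) (x : ℕ → S.Slot) (m k : ℕ) :
    copies π a b x m (some k) ≤ 1 := by
  induction m with
  | zero => simp [copies_some_eq_zero π a b x (Nat.zero_le k)]
  | succ m ih =>
    have h1 := copies_succ_le π a b x m (some k)
    by_cases h : m ≤ k
    · rw [copies_some_eq_zero π a b x h] at h1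
      split_ifs at h1 <;> omega
    · rw [if_neg (by simp; omega)] at h1
      omega

lemma copies_some_eq_zero_of_not_arrival (π : Policy S) (a b : ℕ) (x : ℕ → S.Slot) (m : ℕ) {k : ℕ}
    (h : ¬ (x k).arrival) : copies π a b x m (some k) = 0 := by
  induction m with
  | zero => exact copies_some_eq_zero π a b x (Nat.zero_le k)
  | succ m ih =>
    have h1 := copies_succ_le π a b x m (some k)
    rw [ih, if_neg (by rintro ⟨h2, h3⟩; cases h2; exact h h3)] at h1
    omega

lemma isOccupancy_copies (π : Policy S) (a b : ℕ) (x : ℕ → S.Slot) :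
    IsOccupancy (fun m k => copies π a b x m (some k)) fun m => copies π a b x m none where
  le_one := copies_some_le_one π a b x
  eq_zero _ _ h := copies_some_eq_zero π a b x h
  anti m k h := by
    have h1 := copies_succ_le π a b x m (some k)
    rwa [if_neg (by simp; omega), add_zero] at h1
  rest_anti := antitone_nat_of_succ_le fun m => by
    simpa using copies_succ_le π a b x m none

lemma lengths_eq_copies (π : Policy S) (a b : ℕ) (x : ℕ → S.Slot) (m : ℕ) :
    (S.lengths π a b x m).1 + (S.lengths π a b x m).2 =
      copies π a b x m none + ∑ k ∈ Finset.range m, copies π a b x m (some k) := by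
  set l := (S.queues π a b x m).1 ++ (S.queues π a b x m).2 with hl
  have h1 : ∀ o ∈ (l : Multiset (Option ℕ)),
      o ∈ insert none ((Finset.range m).map Function.Embedding.some) := by
    rintro (_ | k) hk
    · exact Finset.mem_insert_self _ _
    · refine Finset.mem_insert_of_mem (Finset.mem_map_of_mem _ (Finset.mem_range.2 ?_))
      by_contra! h
      have := copies_some_eq_zero π a b x h
      rw [copies, List.count_eq_zero] at this
      exact this (Multiset.mem_coe.1 hk)
  have h2 := Multiset.sum_count_eq_card h1
  rw [Finset.sum_insert (by simp), Finset.sum_map] at h2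
  simp only [Multiset.coe_count, Multiset.coe_card, Function.Embedding.some_apply] at h2
  rw [hl, List.length_append] at h2
  -- Multiset and list counting use different equality tests on `Option ℕ`; both are lawful, hence
  -- equal.
  have hbeq : (instBEqOfDecidableEq : BEq (Option ℕ)) = Option.instBEq :=
    lawful_beq_subsingleton _ _
  rw [hbeq] at h2
  exact h2.symm

lemma slotsInSystem_eq (π : Policy S) (a b : ℕ) (x : ℕ → S.Slot) (k : ℕ) :
    S.slotsInSystem π a b x k = {m | copies π a b x m (some k) ≠ 0} := by
  ext m
  simp only [slotsInSystem, copies, Set.mem_ofPred_eq, ne_eq, List.count_eq_zero, not_not,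
    List.mem_append]

-- A slot without arrival labels no packet and contributes delay `0`, so the numerator may run over
-- all slots, as Little's law needs.
open Classical in
lemma averageDelay_eq (π : Policy S) (a b : ℕ) (x : ℕ → S.Slot) (n : ℕ) :
    S.averageDelay π a b x n =
      (∑ k ∈ Finset.range n, ({m | copies π a b x m (some k) ≠ 0}.ncard : ℝ)) /
        ∑ k ∈ Finset.range n, if (x k).1 = true then (1 : ℝ) else 0 := by
  rw [averageDelay, Finset.card_filter, Finset.sum_filter]
  push_cast
  congr 1
  · refine Finset.sum_congr rfl fun k _ => ?_
    rw [delay, slotsInSystem_eq]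
    split_ifs with h
    · rfl
    · simp [copies_some_eq_zero_of_not_arrival π a b x _ h]
  · exact Finset.sum_congr rfl fun k _ => by
      simp only [Slot.arrival]
      congr

/-- Finite delays and convergence of the average delay along one realization of the slots. -/
lemma tendsto_averageDelay (π : Policy S) (a b : ℕ) (x : ℕ → S.Slot) {l u v : ℝ} (hu : 0 < u)
    (hv : v ≠ 0)
    (hl : Tendsto (fun n : ℕ => (∑ k ∈ Finset.range n,
      (((walk (a, b) (fun m => outcome π (x m)) k).1 : ℝ) +
        (walk (a, b) (fun m => outcome π (x m)) k).2)) / n) atTop (𝓝 l))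
    (he : Tendsto (fun n : ℕ => (∑ k ∈ Finset.range n,
      if walk (a, b) (fun m => outcome π (x m)) k = 0 then (1 : ℝ) else 0) / n) atTop (𝓝 u))
    (ha : Tendsto (fun n : ℕ => (∑ k ∈ Finset.range n, if (x k).1 = true then (1 : ℝ) else 0) / n)
      atTop (𝓝 v)) :
    (∀ k, (S.slotsInSystem π a b x k).Finite) ∧
      Tendsto (fun n => S.averageDelay π a b x n) atTop (𝓝 (l / v)) := by
  simp_rw [← lengths_eq_walk] at hl he
  obtain ⟨h1, h2⟩ := (isOccupancy_copies π a b x).tendsto_sum_ncard (l := l)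
    (lengths_eq_copies π a b x) hu (by simpa only [Nat.cast_add] using hl)
    (by simpa only [add_eq_zero, Prod.ext_iff, Prod.fst_zero, Prod.snd_zero] using he)
  refine ⟨fun k => by rw [slotsInSystem_eq]; exact h1 k, ?_⟩
  refine (h2.div ha hv).congr' ?_
  filter_upwards [eventually_gt_atTop 0] with n hn
  have : (n : ℝ) ≠ 0 := by positivity
  rw [averageDelay_eq, Pi.div_apply, div_div_div_cancel_right₀ this]

end Network

/-! ### The law of one slot -/

lemma integrable_bool {α : Type*} [MeasurableSpace α] {μ : Measure α} [IsProbabilityMeasure μ]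
    {v : α → Bool} (hv : Measurable v) (F : Bool → ℝ) :
    Integrable (fun x => F (v x)) μ ∧ ∫ x, F (v x) ∂μ = bern (μ.real {x | v x = true}) F := by
  have := Measure.isProbabilityMeasure_map (μ := μ) hv.aemeasurable
  have hF : Integrable F (μ.map v) := Integrable.of_finite
  refine ⟨hF.comp_measurable hv, ?_⟩
  have hm : MeasurableSet {x | v x = true} := hv (measurableSet_singleton true)
  have h1 : v ⁻¹' {false} = {x | v x = true}ᶜ := by
    ext x
    simp
  rw [← integral_map hv.aemeasurable hF.aestronglyMeasurable, integral_fintype hF,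
    Fintype.sum_bool, map_measureReal_apply hv (measurableSet_singleton _),
    map_measureReal_apply hv (measurableSet_singleton _), h1, probReal_compl_eq_one_sub hm]
  rfl

/-- Peels one factor off a product measure: a function of a Boolean is affine in its indicator, so
the integrand is a sum of two products. -/
lemma integrable_bool_prod {α β : Type*} [MeasurableSpace α] [MeasurableSpace β] {μ : Measure α}
    {ν : Measure β} [IsProbabilityMeasure μ] [IsProbabilityMeasure ν] {v : α → Bool}
    (hv : Measurable v) {F : Bool → β → ℝ} (hF : ∀ a, Integrable (F a) ν) :
    Integrable (fun z : α × β => F (v z.1) z.2) (μ.prod ν) ∧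
    ∫ z, F (v z.1) z.2 ∂(μ.prod ν) = bern (μ.real {x | v x = true}) fun a => ∫ y, F a y ∂ν := by
  set k : α → ℝ := {x | v x = true}.indicator 1 with hk
  have hm : MeasurableSet {x | v x = true} := hv (measurableSet_singleton true)
  have hki : Integrable k μ := (integrable_const 1).indicator hm
  have h1 : ∀ z : α × β, F (v z.1) z.2 = k z.1 * F true z.2 + (1 - k z.1) * F false z.2 := by
    intro z
    cases h : v z.1 <;> simp [hk, h]
  have i1 := hki.mul_prod (hF true)
  have i2 := ((integrable_const (1 : ℝ)).sub hki).mul_prod (hF false)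
  simp only [Pi.sub_apply] at i2
  simp_rw [h1]
  refine ⟨i1.add i2, ?_⟩
  rw [integral_add i1 i2, integral_prod_mul, integral_prod_mul (fun x => 1 - k x),
    integral_sub (integrable_const _) hki, hk, integral_indicator_one hm]
  simp [bern]

namespace Network

variable (S : Network)

lemma measurableSet_noOutage : MeasurableSet {t | S.NoOutage t} := by
  have : Measurable fun t : ℝ => Real.logb 2 (1 + t) := by
    unfold Real.logb
    fun_prop
  exact measurableSet_le measurable_const this

lemma measurableSet_direct : MeasurableSet {h : ℝ | S.NoOutage (S.P₀ * h / S.N₀)} :=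
  (by fun_prop : Measurable fun h : ℝ => S.P₀ * h / S.N₀) S.measurableSet_noOutage

lemma measurableSet_cluster :
    MeasurableSet {h : Fin S.N → ℝ | ∃ i, S.NoOutage (S.P₀ * h i / S.N₀)} := by
  have : {h : Fin S.N → ℝ | ∃ i, S.NoOutage (S.P₀ * h i / S.N₀)} =
      ⋃ i, (fun h : Fin S.N → ℝ => S.P₀ * h i / S.N₀) ⁻¹' {t | S.NoOutage t} := by
    ext h
    simp
  rw [this]
  exact MeasurableSet.iUnion fun i => (by fun_prop : Measurable fun h : Fin S.N → ℝ =>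
    S.P₀ * h i / S.N₀) S.measurableSet_noOutage

/-- The gains of the links from the SUs for which the relay succeeds. -/
def relaySet (π : Policy S) : Set (CSI S.N) :=
  {h | S.NoOutage ((π.choose h).relayPower * h.2 (π.choose h).relay /
    (S.N₀ + (π.choose h).secondaryPower * h.2 (π.choose h).secondary))}

lemma measurableSet_relaySet (π : Policy S) : MeasurableSet (S.relaySet π) := by
  have h1 := S.measurable_eval_index (measurable_snd (α := Fin S.N → ℝ)) π.measurable_relay
  have h2 := S.measurable_eval_index (measurable_snd (α := Fin S.N → ℝ)) π.measurable_secondary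
  exact ((π.measurable_relayPower.mul h1).div
    ((π.measurable_secondaryPower.mul h2).const_add S.N₀)) S.measurableSet_noOutage

instance : IsProbabilityMeasure (expMeasure (1 / S.varP)) :=
  isProbabilityMeasure_expMeasure (one_div_pos.2 S.varP_pos)

instance : IsProbabilityMeasure (expMeasure 1) := isProbabilityMeasure_expMeasure one_pos

instance : IsProbabilityMeasure S.slotLaw := by
  unfold slotLaw
  infer_instance

/-- Law of the gains of the links from the SUs to the two destinations. -/
def csiLaw : Measure (CSI S.N) :=
  (Measure.pi fun _ => expMeasure 1).prod (Measure.pi fun _ => expMeasure 1)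

instance : IsProbabilityMeasure S.csiLaw := by
  unfold csiLaw
  infer_instance

open Classical in
lemma measurable_decide {α : Type*} [MeasurableSpace α] {s : Set α} (hs : MeasurableSet s) :
    Measurable fun x => decide (x ∈ s) := by
  refine measurable_to_bool ?_
  have : (fun x => decide (x ∈ s)) ⁻¹' {true} = s := by
    ext x
    simp
  rwa [this]

lemma measurable_outcome (π : Policy S) : Measurable (outcome (S := S) π) :=
  measurable_fst.prodMk (((measurable_decide S.measurableSet_direct).comp
    (measurable_fst.comp measurable_snd)).prodMk (((measurable_decide S.measurableSet_cluster).comp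
    (measurable_fst.comp (measurable_snd.comp measurable_snd))).prodMk
    ((measurable_decide (S.measurableSet_relaySet π)).comp
    (measurable_snd.comp (measurable_snd.comp measurable_snd)))))

lemma measureReal_arrival :
    (bernoulliMeasure true false ⟨S.lam, S.lam_pos.le, S.lam_lt_one.le⟩).real
      {x : Bool | x = true} = S.lam := by
  have : {x : Bool | x = true} = {true} := by
    ext x
    simp
  rw [this, bernoulliMeasure_real_apply _ (measurableSet_singleton true)]
  simp

lemma fp_eq : S.fp = (expMeasure (1 / S.varP)).real {h | S.NoOutage (S.P₀ * h / S.N₀)} := by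
  have : {x : S.Slot | S.directSuccess x} =
      Set.univ ×ˢ ({h | S.NoOutage (S.P₀ * h / S.N₀)} ×ˢ Set.univ) := by
    ext x
    simp [directSuccess, Slot.hp]
  rw [fp, this, slotLaw, measureReal_prod_prod, measureReal_prod_prod]
  simp only [probReal_univ, one_mul, mul_one]

lemma fps_eq : S.fps = (Measure.pi fun _ => expMeasure 1).real
    {h : Fin S.N → ℝ | ∃ i, S.NoOutage (S.P₀ * h i / S.N₀)} := by
  have : {x : S.Slot | S.clusterSuccess x} = Set.univ ×ˢ (Set.univ ×ˢ
      ({h : Fin S.N → ℝ | ∃ i, S.NoOutage (S.P₀ * h i / S.N₀)} ×ˢ Set.univ)) := by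
    ext x
    simp [clusterSuccess, Slot.hps]
  rw [fps, this, slotLaw, measureReal_prod_prod, measureReal_prod_prod, measureReal_prod_prod]
  simp only [probReal_univ, one_mul, mul_one]

lemma fr_eq (π : Policy S) : S.fr π = S.csiLaw.real (S.relaySet π) := by
  have : {x : S.Slot | S.relaySuccess π x} = Set.univ ×ˢ (Set.univ ×ˢ
      (Set.univ ×ˢ S.relaySet π)) := by
    ext x
    simp [relaySuccess, relaySet, Slot.hr, Slot.hs]
  rw [fr, this, slotLaw, measureReal_prod_prod, measureReal_prod_prod, measureReal_prod_prod]
  simp only [probReal_univ, one_mul, csiLaw]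

lemma sum_outcome_eq_integral (π : Policy S) (G : Outcome → ℝ) :
    ∑ e, S.slotLaw.real (outcome π ⁻¹' {e}) * G e = ∫ x, G (outcome π x) ∂S.slotLaw := by
  have hm := S.measurable_outcome π
  have := Measure.isProbabilityMeasure_map (μ := S.slotLaw) hm.aemeasurable
  rw [← integral_map (φ := outcome (S := S) π) hm.aemeasurable
    (measurable_of_finite G).aestronglyMeasurable, integral_fintype Integrable.of_finite]
  refine Finset.sum_congr rfl fun e _ => ?_
  rw [map_measureReal_apply hm (measurableSet_singleton e), smul_eq_mul]

lemma sum_busy (π : Policy S) (G : Bool → Bool → Bool → ℝ) :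
    ∑ e, S.slotLaw.real (outcome π ⁻¹' {e}) * G e.1 e.2.1 e.2.2.1 =
      bern S.lam fun a => bern S.fp fun d => bern S.fps fun c => G a d c := by
  classical
  rw [S.sum_outcome_eq_integral π fun e => G e.1 e.2.1 e.2.2.1]
  have h3 := fun a d => integrable_bool_prod (μ := Measure.pi fun _ : Fin S.N => expMeasure 1)
    (ν := S.csiLaw) (measurable_decide S.measurableSet_cluster)
    (F := fun c _ => G a d c) fun _ => integrable_const _
  have h2 := fun a => integrable_bool_prod (μ := expMeasure (1 / S.varP))
    (measurable_decide S.measurableSet_direct) fun d => (h3 a d).1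
  have h1 := integrable_bool_prod
    (μ := bernoulliMeasure true false ⟨S.lam, S.lam_pos.le, S.lam_lt_one.le⟩)
    measurable_id fun a => (h2 a).1
  refine h1.2.trans ?_
  simp only [id, measureReal_arrival, fun a => (h2 a).2, fun a d => (h3 a d).2, decide_eq_true_eq,
    Set.ofPred_mem_eq, integral_const, probReal_univ, one_smul, ← fp_eq, ← fps_eq]

lemma sum_idle (π : Policy S) (G : Bool → Bool → ℝ) :
    ∑ e, S.slotLaw.real (outcome π ⁻¹' {e}) * G e.1 e.2.2.2 =
      bern S.lam fun a => bern (S.fr π) fun r => G a r := by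
  classical
  rw [S.sum_outcome_eq_integral π fun e => G e.1 e.2.2.2]
  have h4 : ∀ a, Integrable (fun h => G a (decide (h ∈ S.relaySet π))) S.csiLaw ∧
      ∫ h, G a (decide (h ∈ S.relaySet π)) ∂S.csiLaw = bern (S.fr π) (G a) := fun a => by
    simpa only [decide_eq_true_eq, Set.ofPred_mem_eq, ← fr_eq] using
      integrable_bool (μ := S.csiLaw) (measurable_decide (S.measurableSet_relaySet π)) (G a)
  -- A factor that the integrand ignores is treated as a Boolean that is always true, an event of
  -- probability one.
  have h3 := fun a => integrable_bool_prod (μ := Measure.pi fun _ : Fin S.N => expMeasure 1)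
    (v := fun _ => true) measurable_const fun _ => (h4 a).1
  have h2 := fun a => integrable_bool_prod (μ := expMeasure (1 / S.varP))
    (v := fun _ => true) measurable_const fun _ => (h3 a).1
  have h1 := integrable_bool_prod
    (μ := bernoulliMeasure true false ⟨S.lam, S.lam_pos.le, S.lam_lt_one.le⟩)
    measurable_id fun a => (h2 a).1
  refine h1.2.trans ?_
  simp only [id, measureReal_arrival, fun a => (h2 a).2, fun a => (h3 a).2, fun a => (h4 a).2]
  simp [bern, -one_div]

/-- The law of the outcome of one slot. -/
def outcomeLaw (π : Policy S) (h : S.lam < S.fr π * (S.fp + (1 - S.fp) * S.fps) /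
    (S.fr π + (1 - S.fp) * S.fps)) : StableLaw :=
  have hfr : 0 ≤ S.fr π := measureReal_nonneg
  have hfp : 0 ≤ S.fp := measureReal_nonneg
  have hfp1 : S.fp ≤ 1 := measureReal_le_one
  have hfps : 0 ≤ S.fps := measureReal_nonneg
  have hc : 0 ≤ (1 - S.fp) * S.fps := mul_nonneg (sub_nonneg.2 hfp1) hfps
  have hpos := S.lam_pos.trans h
  -- With zero relay success the stability bound would be `0`, against a positive arrival rate.
  have hf : 0 < S.fr π := hfr.lt_of_ne fun h0 => by simp [← h0] at hpos
  { weight := fun e => S.slotLaw.real (outcome π ⁻¹' {e})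
    weight_nonneg := fun _ => measureReal_nonneg
    lam := S.lam
    p := S.fp
    q := S.fps
    f := S.fr π
    lam_pos := S.lam_pos
    f_pos := hf
    transfer_nonneg := hc
    sum_busy := S.sum_busy π
    sum_idle := S.sum_idle π
    stable := (lt_div_iff₀ (add_pos_of_pos_of_nonneg hf hc)).1 h }

end Network

end CognitiveRelay

end

/-! ### Matching the closed formulas and assembling the limits -/

theorem theorem2 (S : CognitiveRelay.Network) (policy : CognitiveRelay.Policy S)
    {Ω : Type*} [MeasurableSpace Ω] (P : Measure Ω) [IsProbabilityMeasure P]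
    (X : ℕ → Ω → S.Slot) (hX : ∀ n, Measurable (X n)) (hindep : iIndepFun X P)
    (hlaw : ∀ n, P.map (X n) = S.slotLaw) (a b : ℕ)
    (lam fp fps fr μp r s δ ζ η Np Nr : ℝ)
    (hlam : lam = S.lam) (hfp : fp = S.fp) (hfps : fps = S.fps) (hfr : fr = S.fr policy)
    (hμp : μp = fp + (1 - fp) * fps)
    (hstable : lam < fr * (fp + (1 - fp) * fps) / (fr + (1 - fp) * fps))
    (hr : r = fps * (1 - fp) * ((fr - fp) / μp - fr - fps * (1 - fp)))
    (hs : s = fps * (1 - fp) * μp)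
    (hδ : δ = fr + fps * (1 - fp))
    (hζ : ζ = μp * (-2 * fr - fps * (1 - fp)))
    (hη : η = μp ^ 2 * fr)
    (hNp : Np = (-lam ^ 2 + lam) / (μp - lam))
    (hNr : Nr = (r * lam ^ 2 + s * lam) / (δ * lam ^ 2 + ζ * lam + η)) :
    (∃ p : PMF (ℕ × ℕ),
      (∀ q, Tendsto (fun n => P.real {ω | S.lengths policy a b (fun m => X m ω) n = q}) atTop
        (𝓝 (p q).toReal)) ∧
      HasSum (fun q : ℕ × ℕ => (p q).toReal * q.1) Np ∧
      HasSum (fun q : ℕ × ℕ => (p q).toReal * q.2) Nr) ∧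
    ∀ᵐ ω ∂P,
      (∀ k, (S.slotsInSystem policy a b (fun m => X m ω) k).Finite) ∧
      Tendsto (fun n => S.averageDelay policy a b (fun m => X m ω) n) atTop
        (𝓝 ((Np + Nr) / lam)) := by
  have hst := hstable
  rw [hlam, hfp, hfps, hfr] at hst
  set L := S.outcomeLaw policy hst
  have hL1 : L.lam = lam := hlam.symm
  have hL2 : L.f = fr := hfr.symm
  have hL3 : L.p = fp := hfp.symm
  have hL4 : L.c = (1 - fp) * fps := by rw [hfp, hfps]; rfl
  have hL5 : L.mu = μp := by rw [CognitiveRelay.StableLaw.mu, hL3, hL4, hμp]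
  have hmu := L.mu_pos
  have hmeanP : Np = L.meanPrimary := by
    rw [hNp, CognitiveRelay.StableLaw.meanPrimary, hL1, hL5]
    ring
  have hmeanR : Nr = L.meanRelay := by
    -- The quadratic in the denominator factors into the stability margins of the primary queue and
    -- of the whole system.
    have hden : δ * lam ^ 2 + ζ * lam + η =
        (L.mu - L.lam) * (L.f * L.mu - L.lam * (L.f + L.c)) := by
      rw [hδ, hζ, hη, ← hL1, ← hL2, ← hL5, mul_comm fps, ← hL4]
      ring
    -- The extra factor `mu` clears the division by `μp` inside `r`; it cancels against the `mu` in
    -- the denominator of `meanRelay`.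
    have hnum : L.mu * (r * lam ^ 2 + s * lam) =
        L.c * L.lam * (L.mu * (L.mu - L.lam) + (L.f + L.c) * L.lam * (1 - L.mu)) := by
      have h1 : fp = L.mu - L.c := by rw [CognitiveRelay.StableLaw.mu, hL3]; ring
      rw [hr, hs, mul_comm fps, ← hL4, h1, ← hL1, ← hL2, ← hL5]
      field_simp
      ring
    rw [hNr, hden, CognitiveRelay.StableLaw.meanRelay, ← hnum, mul_assoc L.mu, mul_div_mul_left _ _ hmu.ne']
  have hO := S.measurable_outcome policy
  have H : CognitiveRelay.IsDriving L (fun n ω => CognitiveRelay.Network.outcome policy (X n ω)) P :=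
    { measurable := fun n => hO.comp (hX n)
      indep := hindep.comp _ fun _ => hO
      law := fun n e => by
        change P.real (X n ⁻¹' (CognitiveRelay.Network.outcome policy ⁻¹' {e})) = S.slotLaw.real (CognitiveRelay.Network.outcome policy ⁻¹' {e})
        rw [← hlaw n, map_measureReal_apply (hX n) (hO (measurableSet_singleton e))] }
  have harrival : ∀ᵐ ω ∂P, Tendsto (fun n : ℕ =>
      (∑ k ∈ Finset.range n, if (X k ω).1 = true then (1 : ℝ) else 0) / n) atTop (𝓝 lam) := by
    have hk : Measurable fun x : S.Slot => if x.1 = true then (1 : ℝ) else 0 :=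
      (measurable_of_finite fun v : Bool => if v = true then (1 : ℝ) else 0).comp measurable_fst
    have hmean : ∫ ω, (if (X 0 ω).1 = true then (1 : ℝ) else 0) ∂P = lam := by
      rw [← integral_map (φ := X 0) (f := fun x : S.Slot => if x.1 = true then (1 : ℝ) else 0)
        (hX 0).aemeasurable hk.aestronglyMeasurable, hlaw]
      have h1 := S.sum_outcome_eq_integral policy fun e => if e.1 = true then (1 : ℝ) else 0
      have h2 := S.sum_idle policy fun v _ => if v = true then (1 : ℝ) else 0
      rw [h1] at h2
      refine h2.trans ?_
      simp [CognitiveRelay.bern, hlam]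
    rw [← hmean]
    refine strong_law_ae_real (fun n ω => if (X n ω).1 = true then (1 : ℝ) else 0) ?_
      (fun i j hij => (hindep.indepFun hij).comp hk hk) fun i => ?_
    · refine Integrable.of_bound (hk.comp (hX 0)).aestronglyMeasurable 1 (.of_forall fun ω => ?_)
      change ‖if (X 0 ω).1 = true then (1 : ℝ) else 0‖ ≤ 1
      split_ifs <;> norm_num
    · exact IdentDistrib.comp ⟨(hX i).aemeasurable, (hX 0).aemeasurable, by rw [hlaw, hlaw]⟩ hk
  refine ⟨?_, ?_⟩
  · obtain ⟨p, hp, h1, h2⟩ := L.exists_limit_law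
    refine ⟨p, fun q => ?_, hmeanP ▸ h1, hmeanR ▸ h2⟩
    simp_rw [CognitiveRelay.Network.lengths_eq_walk]
    exact H.tendsto_law (a, b) q (hp q)
  · filter_upwards [H.ae_tendsto_length (a, b), H.ae_tendsto_empty (a, b), harrival] with ω h1 h2 h3
    rw [hmeanP, hmeanR]
    exact CognitiveRelay.Network.tendsto_averageDelay policy a b _ L.probEmpty_pos (hL1 ▸ L.lam_pos.ne') h1 h2 h3
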